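/- **Setting.** Let $m\ge 2$ and $S_j(x)=\rho_jx+b_j$, $0<\rho_j<1$ $(1\le j\le m)$, be maps of $\mathbb R$ with $S_j((0,1))\subset(0,1)$ for all $j$, numbered so that $S_1(0)=0$ and $S_m(1)=1$. Let $K$ be the attractor and $\alpha=\dim_HK$, and assume $\alpha<1$. For a word $\mathbf i=(i_1,\dots,i_n)$ put $S_{\mathbf i}=S_{i_1}\circ\cdots\circ S_{i_n}$. Let $(\mathcal M_k)_{k\ge0}$ be a sequence of nested index sets, i.e. finite sets of words with $\mathcal M_0=\{\emptyset\}$ such that: (1) the minimal and the maximal length of the words of $\mathcal M_k$ are non-decreasing in $k$ and tend to infinity; (2) distinct words of $\mathcal M_k$ are incomparable, i.e. neither is an initial segment of the other; (3) every word longer than all words of $\mathcal M_k$ has an initial segment in $\mathcal M_k$; (4) every word shorter than all words of $\mathcal M_k$ is an initial segment of a word of $\mathcal M_k$; (5) there is a positive integer $L$ with $|\mathbf j|-|\mathbf i|\le L$ whenever $\mathbf i\in\mathcal M_k$ is an initial segment of $\mathbf j\in\mathcal M_{k+1}$. Put $U_k=\bigcup_{\mathbf i\in\mathcal M_k}S_{\mathbf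 i}((0,1))$ and assume $U_{k+1}\subset U_k$ for all $k$. The *$k$-th generation islands* are the closures of the connected components of $U_k$; the *$k$-th generation lakes* are the (possibly empty) open intervals between consecutive $k$-th generation islands. For a $k$-th generation island $I$ let $V(I)$ be the set of maps $S_{\mathbf i}$, $\mathbf i\in\mathcal M_k$, with $S_{\mathbf i}([0,1])\subset I$. Islands $I$ of generation $k$ and $I'$ of generation $k'$ have the same *overlap type* if there is an affine bijection $\tau$ of $\mathbb R$ with $\tau(I)=I'$ and $V(I')=\{\tau\circ f: f\in V(I)\}$ such that, for all $l\ge1$ and $J\subset\mathbb R$, $J$ is a $(k+l)$-th generation island contained in $I$ if and only if $\tau(J)$ is a $(k'+l)$-th generation island contained in $I'$. Assume that there are only finitely many overlap types (generalized finite type condition), and that the weighted incidence matrix $A_\alpha$ is irreducible. Its rows and columns are indexed by the overlap types, and $A_\alpha(T,T')=\sum(|J|/|I|)^\alpha$, where $I$ is an island of type $T$, of generation $k$ say, and the sum is over the $(k+1)$-th generation islands $J\subset I$ of type $T'$. Let $k_0\ge0$ be the least integer such that every $(k_0+1)$-th generation island has the overlap type of some island of generation at most $k_0$. Let $\beta_{\max}^{(k)}$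 be the maximal length of the $k$-th generation islands and $\gamma_{\min}^{(k)}$ the minimal length of the $k$-th generation lakes. For a nondegenerate interval $J\subset[0,1]$ let $$d(J)=\frac{\mathcal H^\alpha(K\cap J)}{\mathcal H^\alpha(K)\,|J|^\alpha},\qquad d_{\max}=\sup_{J\subset[0,1]}d(J),\qquad \underline D_0=\inf_{0<x\le1}d([0,x]),\qquad \underline D_1=\inf_{0<x\le1}d([1-x,1]).$$ An *interval in $\mathcal F_k$* is a nondegenerate interval $[z_1,z_2]$ where $z_1$ is the left endpoint of a $k$-th generation island and $z_2$ is the right endpoint of a $k$-th generation island. **Theorem 4.8.** Assume moreover: * (Assumption A) for every island $I$ and distinct $f,g\in V(I)$, $f([0,1])\not\subset g([0,1])$; * (Assumption B) $S_1([0,1])\cap K=S_1(K)$ and $S_m([0,1])\cap K=S_m(K)$; * all $(k_0+1)$-th generation lakes are nonempty, i.e. $\gamma_{\min}^{(k_0+1)}>0$. Then there is a least integer $k\ge k_0+1$ with $$2\beta_{\max}^{(k)}\le\bigl(\gamma_{\min}^{(k_0+1)}\min\{\underline D_0,\underline D_1\}\bigr)^{1/(1-\alpha)},$$ and for this $k$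 the maximal density $d_{\max}$ is attained by an interval in $\mathcal F_k$. Moreover $0<\mathcal H^\alpha(K)<\infty$ and $\mathcal H^\alpha(K)=d_{\max}^{-1}$. -/

import Mathlib

open MeasureTheory Set Filter
open scoped ENNReal NNReal

noncomputable section

/-- A linear IFS `S_j x = ρ_j x + b_j` on the line, with contraction ratios `0 < ρ_j < 1`. -/
structure LinearIFS (m : ℕ) where
  ratio : Fin m → ℝ
  shift : Fin m → ℝ
  ratio_pos : ∀ j, 0 < ratio j
  ratio_lt_one : ∀ j, ratio j < 1

namespace LinearIFS

variable {m : ℕ} (Φ : LinearIFS m)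

/-- The similitude `S_j`. -/
def map (j : Fin m) (x : ℝ) : ℝ := Φ.ratio j * x + Φ.shift j

/-- `S_w = S_{w₁} ∘ ⋯ ∘ S_{wₙ}` for a word `w`; the identity for the empty word. -/
def wordMap : List (Fin m) → ℝ → ℝ
  | [] => id
  | j :: w => Φ.map j ∘ wordMap w

/-- `K` is the attractor: the nonempty compact set with `K = ⋃ j, S_j K`. -/
structure IsAttractor (K : Set ℝ) : Prop where
  isCompact : IsCompact K
  nonempty : K.Nonempty
  eq_iUnion : K = ⋃ j, Φ.map j '' K

/-- The open interval `(0,1)` is invariant under the IFS. -/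
def UnitIntervalInvariant : Prop := ∀ j, Φ.map j '' Ioo 0 1 ⊆ Ioo 0 1

end LinearIFS

/-- Minimal length of the words in a finite set of words. -/
def minLength {m : ℕ} (A : Finset (List (Fin m))) : ℕ :=
  sInf (List.length '' (A : Set (List (Fin m))))

/-- Maximal length of the words in a finite set of words. -/
def maxLength {m : ℕ} (A : Finset (List (Fin m))) : ℕ := A.sup List.length

/-- A sequence of nested index sets. The relation `u <+: w` says that `u` is an initial segment
of `w`. -/
structure NestedIndexSets {m : ℕ} (M : ℕ → Finset (List (Fin m))) : Prop where
  zero : M 0 = {[]}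
  minLength_mono : Monotone fun k => minLength (M k)
  maxLength_mono : Monotone fun k => maxLength (M k)
  minLength_tendsto : Tendsto (fun k => minLength (M k)) atTop atTop
  maxLength_tendsto : Tendsto (fun k => maxLength (M k)) atTop atTop
  incomparable : ∀ k, ∀ u ∈ M k, ∀ w ∈ M k, u ≠ w → ¬ u <+: w
  exists_prefix : ∀ k, ∀ w : List (Fin m), maxLength (M k) < w.length → ∃ u ∈ M k, u <+: w
  exists_extension : ∀ k, ∀ w : List (Fin m), w.length < minLength (M k) → ∃ u ∈ M k, w <+: u
  bounded_growth : ∃ L : ℕ, 0 < L ∧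
    ∀ k, ∀ u ∈ M k, ∀ w ∈ M (k + 1), u <+: w → w.length ≤ u.length + L

namespace LinearIFS

variable {m : ℕ} (Φ : LinearIFS m) (M : ℕ → Finset (List (Fin m)))

/-- The maps `S_v` of the `k`-th generation vertices `v` (words with the same map give the same
vertex). -/
def vertexMaps (k : ℕ) : Set (ℝ → ℝ) := Φ.wordMap '' (M k : Set (List (Fin m)))

/-- The union of the open intervals `S_v (0,1)` over the `k`-th generation vertices. -/
def openUnion (k : ℕ) : Set ℝ := ⋃ f ∈ Φ.vertexMaps M k, f '' Ioo 0 1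

/-- The `k`-th generation islands: the closures of the connected components of `openUnion`. -/
def islands (k : ℕ) : Set (Set ℝ) :=
  {I | ∃ x ∈ Φ.openUnion M k, I = closure (connectedComponentIn (Φ.openUnion M k) x)}

/-- `V(I)` for a `k`-th generation island `I`: the vertices whose interval lies in `I`. -/
def islandVertices (k : ℕ) (I : Set ℝ) : Set (ℝ → ℝ) :=
  {f | f ∈ Φ.vertexMaps M k ∧ f '' Icc 0 1 ⊆ I}

/-- An island together with its generation. -/
structure Island where
  gen : ℕ
  carrier : Set ℝ
  mem : carrier ∈ Φ.islands M gen

/-- Equivalence of islands: a linear function `τ` maps `I` onto `I'`, matches their constitutive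
maps, and matches the islands of every later generation contained in them. -/
def IslandEquiv (I I' : Φ.Island M) : Prop :=
  ∃ τ : ℝ ≃ᵃ[ℝ] ℝ, τ '' I.carrier = I'.carrier ∧
    Φ.islandVertices M I'.gen I'.carrier
      = (fun f => τ ∘ f) '' Φ.islandVertices M I.gen I.carrier ∧
    ∀ l : ℕ, 1 ≤ l → ∀ J : Set ℝ,
      (J ∈ Φ.islands M (I.gen + l) ∧ J ⊆ I.carrier) ↔
        (τ '' J ∈ Φ.islands M (I'.gen + l) ∧ τ '' J ⊆ I'.carrier)

theorem islandEquiv_equivalence : Equivalence (Φ.IslandEquiv M) where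
  refl I := ⟨AffineEquiv.refl ℝ ℝ, by simp, by ext f; simp, by simp⟩
  symm := by
    rintro I I' ⟨τ, h1, h2, h3⟩
    have key : ∀ S : Set ℝ, τ '' (τ.symm '' S) = S := fun S => by
      rw [← image_comp]; simp
    have key' : ∀ S : Set ℝ, τ.symm '' (τ '' S) = S := fun S => by
      rw [← image_comp]; simp
    refine ⟨τ.symm, by rw [← h1, key'], ?_, fun l hl J => ?_⟩
    · rw [h2, ← image_comp]
      ext f
      simp [Function.comp_def]
    · rw [h3 l hl (τ.symm '' J), key]
  trans := by
    rintro I I' I'' ⟨τ, h1, h2, h3⟩ ⟨σ, g1, g2, g3⟩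
    refine ⟨τ.trans σ, ?_, ?_, fun l hl J => ?_⟩
    · rw [← g1, ← h1, ← image_comp]; rfl
    · rw [g2, h2, ← image_comp]; rfl
    · rw [h3 l hl J, g3 l hl (τ '' J), ← image_comp]; rfl

/-- The equivalence of islands as a setoid; its classes are the overlap types. -/
def islandSetoid : Setoid (Φ.Island M) := ⟨Φ.IslandEquiv M, Φ.islandEquiv_equivalence M⟩

/-- The overlap types. -/
def OverlapType : Type := Quotient (Φ.islandSetoid M)

/-- The overlap type `[I]`. -/
def typeOf (I : Φ.Island M) : Φ.OverlapType M := Quotient.mk (Φ.islandSetoid M) I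

/-- A chosen island of a given overlap type. -/
def representative (T : Φ.OverlapType M) : Φ.Island M := Quotient.out T

/-- The offsprings of `I`: the islands of the next generation contained in `I`. -/
def offsprings (I : Φ.Island M) : Set (Φ.Island M) :=
  {J | J.gen = I.gen + 1 ∧ J.carrier ⊆ I.carrier}

/-- The weighted incidence matrix `A_α`: the entry `(T, T')` is the sum of `(|J| / |I|) ^ α` over
the offsprings `J` of type `T'` of an island `I` of type `T`. -/
def incidenceMatrix (α : ℝ) : Matrix (Φ.OverlapType M) (Φ.OverlapType M) ℝ :=
  fun T T' => ∑ᶠ J ∈ {J | J ∈ Φ.offsprings M (Φ.representative M T) ∧ Φ.typeOf M J = T'},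
    (Metric.diam J.carrier / Metric.diam (Φ.representative M T).carrier) ^ α

/-- The generalized finite type condition with respect to `(0,1)`, realized by the index sets
`M`. The field `nested` makes explicit that the sets `⋃ S_v (0,1)` decrease with the
generation. -/
structure GeneralizedFiniteType : Prop where
  invariant : Φ.UnitIntervalInvariant
  indexSets : NestedIndexSets M
  nested : ∀ k, Φ.openUnion M (k + 1) ⊆ Φ.openUnion M k
  finite : Finite (Φ.OverlapType M)

/-- None of the islands of generation `k + 1` is of a new overlap type. -/
def NoNewType (k : ℕ) : Prop :=
  ∀ I : Φ.Island M, I.gen = k + 1 →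
    ∃ I' : Φ.Island M, I'.gen ≤ k ∧ Φ.typeOf M I' = Φ.typeOf M I

/-- Assumption A: no constitutive interval of an island contains another one. -/
def AssumptionA : Prop :=
  ∀ I : Φ.Island M, ∀ f ∈ Φ.islandVertices M I.gen I.carrier,
    ∀ g ∈ Φ.islandVertices M I.gen I.carrier, f ≠ g → ¬ f '' Icc 0 1 ⊆ g '' Icc 0 1

/-- Assumption B, for an IFS whose first and last maps have indices `0` and `Fin.last`. -/
def AssumptionB {n : ℕ} (Φ : LinearIFS (n + 2)) (K : Set ℝ) : Prop :=
  Φ.map 0 '' Icc 0 1 ∩ K = Φ.map 0 '' K ∧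
    Φ.map (Fin.last (n + 1)) '' Icc 0 1 ∩ K = Φ.map (Fin.last (n + 1)) '' K

/-- `β_max^(k)`: the maximal length of the `k`-th generation islands. -/
def islandMax (k : ℕ) : ℝ := sSup (Metric.diam '' Φ.islands M k)

/-- `(a,b)` is a `k`-th generation lake: the possibly empty open interval between two
consecutive `k`-th generation islands. -/
def IsGap (k : ℕ) (a b : ℝ) : Prop :=
  a ≤ b ∧ (∃ I ∈ Φ.islands M k, sSup I = a) ∧ (∃ I ∈ Φ.islands M k, sInf I = b) ∧
    ∀ I ∈ Φ.islands M k, Disjoint I (Ioo a b)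

/-- `γ_min^(k)`: the minimal length of the `k`-th generation lakes. -/
def lakeMin (k : ℕ) : ℝ := sInf {c | ∃ a b, Φ.IsGap M k a b ∧ c = b - a}

/-- The intervals of the `k`-th generation field: they begin at the left endpoint of a `k`-th
generation island and end at the right endpoint of one (lakes in between being included). -/
def fieldIntervals (k : ℕ) : Set (Set ℝ) :=
  {J | ∃ I ∈ Φ.islands M k, ∃ I' ∈ Φ.islands M k,
    sInf I < sSup I' ∧ J = Icc (sInf I) (sSup I')}

end LinearIFS

/-- `λ(J)`, for the normalized restriction `λ = μH[α]|_K / μH[α](K)`. -/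
def normalizedMeasure (K : Set ℝ) (α : ℝ) (J : Set ℝ) : ℝ :=
  (Measure.hausdorffMeasure α (K ∩ J)).toReal / (Measure.hausdorffMeasure α K).toReal

/-- The density `d(J) = λ(J) / |J| ^ α`. -/
def density (K : Set ℝ) (α : ℝ) (J : Set ℝ) : ℝ :=
  normalizedMeasure K α J / Metric.diam J ^ α

/-- The densities of all nondegenerate intervals `J ⊆ [0,1]` (open, closed or half-open). -/
def densities (K : Set ℝ) (α : ℝ) : Set ℝ :=
  {c | ∃ J : Set ℝ, J ⊆ Icc 0 1 ∧ J.OrdConnected ∧ J.Nontrivial ∧ c = density K α J}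

/-- The maximal density `d_max`. -/
def maxDensity (K : Set ℝ) (α : ℝ) : ℝ := sSup (densities K α)

/-- The lower density at the left end of the root island `[0,1]`. -/
def lowerDensityLeft (K : Set ℝ) (α : ℝ) : ℝ :=
  sInf {c | ∃ x : ℝ, 0 < x ∧ x ≤ 1 ∧ c = density K α (Icc 0 x)}

/-- The lower density at the right end of the root island `[0,1]`. -/
def lowerDensityRight (K : Set ℝ) (α : ℝ) : ℝ :=
  sInf {c | ∃ x : ℝ, 0 < x ∧ x ≤ 1 ∧ c = density K α (Icc (1 - x) 1)}

end

/-! ### Finite covers, and the ratios of disjoint similar copies. -/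

section HausdorffMeasureReal

open scoped Topology
open Metric (ediam)

/-! Write λ for the normalized Hausdorff measure on K, H for the α-dimensional measure of K, and γ
for `Φ.lakeMin M (k₀ + 1)`. The central device is a blow-up. For points x < y of K, take the last
generation in which one island contains both. As no new type appears in generation k₀ + 1, an
increasing affine map carries this island, with its part of K and its descendants, onto an island of
generation at most k₀. The images of x and y lie in distinct offsprings, hence at least γ apart
(`exists_islandSimilar_lakeMin_le`). Density is invariant under the blow-up, so only intervals of
length at least γ compete. Their endpoints form a compact set on which density is continuous, and a
maximizer [p, q] exists (`exists_isMax_density`).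

Suppose p were inside a vertex interval of generation k. Extending [p, q] by a length x to the left
end of that interval adds mass at least D₀ x^α, where D₀ is the lower density at 0. Maximality,
Bernoulli's inequality and α < 1 force x > (γ D₀)^(1/(1-α)), which exceeds every island length of
generation k. The same holds at q, so both endpoints avoid the open union
(`endpoints_notMem_openUnion`). If p or q were not an island endpoint, cutting off a null piece
would raise the density (`mem_fieldIntervals_of_isMax`).

The blow-up also covers each portion of K between two of its points by boundedly many copies of K of
comparable size, which makes H positive (`hausdorffMeasure_ne_zero_of_portions`). Conversely, the
islands of one generation are disjoint, and each contains a copy of K of comparable size. Disjoint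
copies have Σ ρ^α ≤ 1 (`sum_rpow_le_one_of_pairwise_disjoint`), so H is finite. Placing copies of an
interval J in these islands shows that K ∩ J has measure at most |J|^α
(`hausdorffMeasure_inter_Icc_le`), so d_max · H ≤ 1. The mass distribution principle gives the
reverse inequality (`one_le_mul_of_density_le`). -/

theorem exists_finite_cover_of_hausdorffMeasure_eq_zero {K : Set ℝ} (hK : IsCompact K) {s : ℝ}
    (hs : 0 < s) (h0 : Measure.hausdorffMeasure s K = 0) {ε : ℝ} (hε : 0 < ε) :
    ∃ (C : Finset ℕ) (p q : ℕ → ℝ), (∀ n, p n < q n) ∧ (K ⊆ ⋃ n ∈ C, Icc (p n) (q n)) ∧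
      ∑ n ∈ C, (q n - p n) ^ s < ε := by
  -- A set of diameter d is enlarged to an interval of length 4 max(d, η n), where η n > 0 prevents
  -- degeneracy. The powers of the d sum to at most c and those of the η n to at most 2c, so the
  -- total is at most 4^s · 3c = 3ε/4.
  have hc : (0 : ℝ) < ε / (4 * 4 ^ s) := by positivity
  set c := ε / (4 * 4 ^ s) with hcdef
  rw [Measure.hausdorffMeasure_apply] at h0
  have h1 : (⨅ (t : ℕ → Set ℝ) (_ : K ⊆ ⋃ n, t n) (_ : ∀ n, ediam (t n) ≤ 1),
      ∑' n, ⨆ _ : (t n).Nonempty, ediam (t n) ^ s) ≤ 0 := by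
    rw [← h0]
    exact le_iSup₂_of_le (1 : ℝ≥0∞) one_pos le_rfl
  have h2 := h1.trans_lt (ENNReal.ofReal_pos.2 hc)
  simp only [iInf_lt_iff] at h2
  obtain ⟨t, htK, htd, hsum⟩ := h2
  have hb : ∀ n, Bornology.IsBounded (t n) := fun n =>
    Metric.isBounded_iff_ediam_ne_top.2 ((htd n).trans_lt ENNReal.one_lt_top).ne
  set η : ℕ → ℝ := fun n => (c * (1 / 2) ^ n) ^ (1 / s) with hη
  have hηpos : ∀ n, 0 < η n := fun n => by positivity
  have hηs : ∀ n, η n ^ s = c * (1 / 2) ^ n := fun n => by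
    rw [hη, ← Real.rpow_mul (by positivity), one_div_mul_cancel hs.ne', Real.rpow_one]
  set d : ℕ → ℝ := fun n => Metric.diam (t n) with hd
  have hd0 : ∀ n, 0 ≤ d n := fun n => Metric.diam_nonneg
  set r : ℕ → ℝ := fun n => max (d n) (η n) with hr
  have hr0 : ∀ n, 0 < r n := fun n => (hηpos n).trans_le (le_max_right _ _)
  have hx : ∀ n, ∃ x, t n ⊆ Ioo (x - 2 * r n) (x + 2 * r n) := by
    intro n
    rcases (t n).eq_empty_or_nonempty with he | ⟨x, hxt⟩
    · exact ⟨0, by simp [he]⟩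
    · refine ⟨x, fun y hy => ?_⟩
      have h3 : |y - x| ≤ r n := (Real.dist_eq y x ▸
        Metric.dist_le_diam_of_mem (hb n) hy hxt).trans (le_max_left _ _)
      have := hr0 n
      rw [abs_le] at h3
      constructor <;> linarith
  choose x hx using hx
  have hcov : K ⊆ ⋃ n, Ioo (x n - 2 * r n) (x n + 2 * r n) :=
    htK.trans (iUnion_mono hx)
  obtain ⟨C, hC⟩ := hK.elim_finite_subcover _ (fun n => isOpen_Ioo) hcov
  refine ⟨C, fun n => x n - 2 * r n, fun n => x n + 2 * r n, fun n => ?_,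
    hC.trans (iUnion₂_mono fun n _ => Ioo_subset_Icc_self), ?_⟩
  · have := hr0 n
    dsimp only
    linarith
  have hle : ∀ n, (x n + 2 * r n - (x n - 2 * r n)) ^ s ≤ 4 ^ s * (d n ^ s + η n ^ s) := by
    intro n
    have : x n + 2 * r n - (x n - 2 * r n) = 4 * r n := by ring
    rw [this, Real.mul_rpow (by norm_num) (hr0 n).le]
    gcongr
    rcases max_cases (d n) (η n) with ⟨h, -⟩ | ⟨h, -⟩
    · rw [hr]; dsimp only; rw [h]; linarith [Real.rpow_nonneg (hηpos n).le s]
    · rw [hr]; dsimp only; rw [h]; linarith [Real.rpow_nonneg (hd0 n) s]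
  have hdsum : ∑ n ∈ C, d n ^ s ≤ c := by
    have h4 : ∀ n, ENNReal.ofReal (d n ^ s) ≤ ⨆ _ : (t n).Nonempty, ediam (t n) ^ s := by
      intro n
      rcases (t n).eq_empty_or_nonempty with he | hne
      · simp [hd, he, Real.zero_rpow hs.ne']
      · rw [ciSup_pos hne, ← ENNReal.ofReal_rpow_of_nonneg (hd0 n) hs.le]
        gcongr
        exact ENNReal.ofReal_toReal_le
    have h5 : ENNReal.ofReal (∑ n ∈ C, d n ^ s) ≤ ENNReal.ofReal c := by
      rw [ENNReal.ofReal_sum_of_nonneg fun n _ => Real.rpow_nonneg (hd0 n) s]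
      calc _ ≤ ∑ n ∈ C, ⨆ _ : (t n).Nonempty, ediam (t n) ^ s := Finset.sum_le_sum fun n _ => h4 n
        _ ≤ _ := (ENNReal.sum_le_tsum C).trans hsum.le
    exact (ENNReal.ofReal_le_ofReal_iff hc.le).1 h5
  have hηsum : ∑ n ∈ C, η n ^ s ≤ c * 2 := by
    simp only [hηs]
    rw [← Finset.mul_sum]
    gcongr
    exact (summable_geometric_two.sum_le_tsum C fun n _ => by positivity).trans_eq
      tsum_geometric_two
  calc _ ≤ ∑ n ∈ C, 4 ^ s * (d n ^ s + η n ^ s) := Finset.sum_le_sum fun n _ => hle n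
    _ = 4 ^ s * (∑ n ∈ C, d n ^ s + ∑ n ∈ C, η n ^ s) := by
      rw [← Finset.mul_sum, Finset.sum_add_distrib]
    _ ≤ 4 ^ s * (c + c * 2) := by gcongr
    _ < ε := by
      rw [hcdef]
      have : (0 : ℝ) < 4 ^ s := by positivity
      field_simp
      norm_num

/-- Finite covers of a set that contains well separated similar copies of itself. -/
theorem rpow_le_sum_of_cover {κ : Type*} {K : Set ℝ} (hne : K.Nonempty) {S : Finset κ}
    (hS : 1 < S.card) {ρ σ : κ → ℝ} (hρ : ∀ i ∈ S, 0 < ρ i)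
    (hmap : ∀ i ∈ S, ∀ x ∈ K, ρ i * x + σ i ∈ K) {δ : ℝ} (hδ0 : 0 ≤ δ)
    (hδ : ∀ i ∈ S, ∀ j ∈ S, i ≠ j → ∀ x ∈ K, ∀ y ∈ K, δ ≤ |ρ i * x + σ i - (ρ j * y + σ j)|)
    {s : ℝ} (hs : 0 ≤ s) (hsum : 1 ≤ ∑ i ∈ S, ρ i ^ s) (m : ℕ) :
    ∀ (C : Finset ℕ), C.card = m → ∀ (p q : ℕ → ℝ), (∀ n, p n < q n) →
      (K ⊆ ⋃ n ∈ C, Icc (p n) (q n)) → δ ^ s ≤ ∑ n ∈ C, (q n - p n) ^ s := by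
  classical
  induction m using Nat.strong_induction_on with
  | _ m ih =>
  intro C hC p q hpq hcov
  have hnn : ∀ n, 0 ≤ (q n - p n) ^ s := fun n => Real.rpow_nonneg (sub_pos.2 (hpq n)).le s
  by_cases hbig : ∃ n ∈ C, δ ≤ q n - p n
  · obtain ⟨n, hn, hle⟩ := hbig
    exact (Real.rpow_le_rpow hδ0 hle hs).trans
      (Finset.single_le_sum (f := fun n => (q n - p n) ^ s) (fun n _ => hnn n) hn)
  push Not at hbig
  -- All intervals are now shorter than δ, so each meets at most one copy. Those meeting copy i,
  -- pulled back to K, form a cover with fewer members, because every other copy needs an interval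
  -- too.
  set D : κ → Finset ℕ := fun i =>
    C.filter fun n => ∃ x ∈ K, ρ i * x + σ i ∈ Icc (p n) (q n) with hD
  have hDsub : ∀ i, D i ⊆ C := fun i => Finset.filter_subset _ _
  have hdisj : ∀ i ∈ S, ∀ j ∈ S, i ≠ j → Disjoint (D i) (D j) := by
    intro i hi j hj hij
    rw [Finset.disjoint_left]
    intro n hni hnj
    simp only [hD, Finset.mem_filter] at hni hnj
    obtain ⟨hnC, x, hx, hx1, hx2⟩ := hni
    obtain ⟨-, y, hy, hy1, hy2⟩ := hnj
    have h1 := hδ i hi j hj hij x hx y hy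
    have h2 := hbig n hnC
    have : |ρ i * x + σ i - (ρ j * y + σ j)| ≤ q n - p n := abs_le.2 ⟨by linarith, by linarith⟩
    linarith
  have hDne : ∀ i ∈ S, (D i).Nonempty := by
    intro i hi
    obtain ⟨x, hx⟩ := hne
    obtain ⟨n, hn, hxn⟩ := mem_iUnion₂.1 (hcov (hmap i hi x hx))
    exact ⟨n, Finset.mem_filter.2 ⟨hn, x, hx, hxn⟩⟩
  have hcard : ∀ i ∈ S, (D i).card < m := by
    intro i hi
    obtain ⟨j, hj, hji⟩ := Finset.exists_mem_ne hS i
    rw [← hC]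
    refine Finset.card_lt_card ((Finset.ssubset_iff_of_subset (hDsub i)).2 ?_)
    obtain ⟨n, hn⟩ := hDne j hj
    exact ⟨n, hDsub j hn, Finset.disjoint_left.1 (hdisj j hj i hi hji) hn⟩
  have hstep : ∀ i ∈ S, ρ i ^ s * δ ^ s ≤ ∑ n ∈ D i, (q n - p n) ^ s := by
    intro i hi
    have hρi := hρ i hi
    have h1 := ih (D i).card (hcard i hi) (D i) rfl (fun n => (p n - σ i) / ρ i)
      (fun n => (q n - σ i) / ρ i)
      (fun n => by gcongr; exact hpq n) (by
        intro x hx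
        obtain ⟨n, hn, hxn⟩ := mem_iUnion₂.1 (hcov (hmap i hi x hx))
        refine mem_iUnion₂.2 ⟨n, Finset.mem_filter.2 ⟨hn, x, hx, hxn⟩, ?_⟩
        rw [mem_Icc, div_le_iff₀ hρi, le_div_iff₀ hρi]
        constructor <;> linarith [hxn.1, hxn.2])
    have h2 : ∀ n, ((q n - σ i) / ρ i - (p n - σ i) / ρ i) ^ s
        = (q n - p n) ^ s / ρ i ^ s := by
      intro n
      rw [← Real.div_rpow (sub_pos.2 (hpq n)).le hρi.le]
      congr 1
      field_simp
      ring
    simp only [h2] at h1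
    rw [← Finset.sum_div, le_div_iff₀ (by positivity)] at h1
    linarith
  calc δ ^ s ≤ (∑ i ∈ S, ρ i ^ s) * δ ^ s :=
        le_mul_of_one_le_left (Real.rpow_nonneg hδ0 s) hsum
    _ = ∑ i ∈ S, ρ i ^ s * δ ^ s := Finset.sum_mul _ _ _
    _ ≤ ∑ i ∈ S, ∑ n ∈ D i, (q n - p n) ^ s := Finset.sum_le_sum hstep
    _ = ∑ n ∈ S.biUnion D, (q n - p n) ^ s := (Finset.sum_biUnion hdisj).symm
    _ ≤ ∑ n ∈ C, (q n - p n) ^ s :=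
        Finset.sum_le_sum_of_subset_of_nonneg (Finset.biUnion_subset.2 fun i _ => hDsub i)
          fun n _ _ => hnn n

theorem IsCompact.eventually_le_dist_of_disjoint {A B : Set ℝ} (hA : IsCompact A)
    (hB : IsCompact B) (h : Disjoint A B) :
    ∀ᶠ δ in 𝓝[>] (0 : ℝ), ∀ x ∈ A, ∀ y ∈ B, δ ≤ |x - y| := by
  obtain ⟨δ, hδ, hd⟩ := h.exists_thickenings hA hB.isClosed
  filter_upwards [Ioo_mem_nhdsGT hδ] with ε hε x hx y hy
  by_contra hlt
  push Not at hlt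
  refine Set.disjoint_left.1 hd (Metric.mem_thickening_iff.2 ⟨x, hx, ?_⟩)
    (Metric.self_subset_thickening hδ B hy)
  rw [Real.dist_eq, abs_sub_comm]
  exact hlt.trans hε.2

/-- If a compact set contains pairwise disjoint similar copies of itself, with ratios `ρ i`, then
`∑ ρ i ^ α ≤ 1` for its dimension `α`. -/
theorem sum_rpow_le_one_of_pairwise_disjoint {κ : Type*} {K : Set ℝ} (hK : IsCompact K)
    (hne : K.Nonempty) {α : ℝ≥0} (hα : dimH K = α) {S : Finset κ} {ρ σ : κ → ℝ}
    (hρ : ∀ i ∈ S, 0 < ρ i) (hρ1 : ∀ i ∈ S, ρ i ≤ 1)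
    (hmap : ∀ i ∈ S, ∀ x ∈ K, ρ i * x + σ i ∈ K)
    (hdisj : ∀ i ∈ S, ∀ j ∈ S, i ≠ j →
      Disjoint ((fun x => ρ i * x + σ i) '' K) ((fun x => ρ j * x + σ j) '' K)) :
    ∑ i ∈ S, ρ i ^ (α : ℝ) ≤ 1 := by
  rcases le_or_gt S.card 1 with hS | hS
  · rcases Finset.eq_empty_or_nonempty S with rfl | hSn
    · simp
    · obtain ⟨i, rfl⟩ := Finset.card_eq_one.1 (le_antisymm hS hSn.card_pos)
      rw [Finset.sum_singleton]
      exact Real.rpow_le_one (hρ i (by simp)).le (hρ1 i (by simp)) α.coe_nonneg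
  by_contra hlt
  push Not at hlt
  have hcomp : ∀ i, IsCompact ((fun x => ρ i * x + σ i) '' K) := fun i =>
    hK.image (by fun_prop)
  have h1 : ∀ᶠ δ in 𝓝[>] (0 : ℝ), ∀ i ∈ S, ∀ j ∈ S, i ≠ j → ∀ x ∈ K, ∀ y ∈ K,
      δ ≤ |ρ i * x + σ i - (ρ j * y + σ j)| := by
    rw [Finset.eventually_all]
    intro i hi
    rw [Finset.eventually_all]
    intro j hj
    rw [eventually_imp_distrib_left]
    intro hij
    filter_upwards [(hcomp i).eventually_le_dist_of_disjoint (hcomp j) (hdisj i hi j hj hij)]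
      with δ hδ x hx y hy
    exact hδ _ ⟨x, hx, rfl⟩ _ ⟨y, hy, rfl⟩
  obtain ⟨δ, hδ, hδ0⟩ := (h1.and self_mem_nhdsWithin).exists
  -- A sum exceeding 1 at α still exceeds 1 at some s > α. There the s-dimensional measure of K
  -- vanishes, while the separated copies keep every cover sum above δ^s.
  have hcont : ContinuousAt (fun s : ℝ => ∑ i ∈ S, ρ i ^ s) α :=
    tendsto_finsetSum _ fun i hi =>
      Real.continuousAt_const_rpow (hρ i hi).ne'
  have h2 : ∀ᶠ s in 𝓝[>] (α : ℝ), 1 < ∑ i ∈ S, ρ i ^ s :=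
    (hcont.eventually (lt_mem_nhds hlt)).filter_mono nhdsWithin_le_nhds
  obtain ⟨s, hs, hαs⟩ := (h2.and self_mem_nhdsWithin).exists
  have hs0 : 0 < s := α.coe_nonneg.trans_lt hαs
  have hzero : Measure.hausdorffMeasure s K = 0 := by
    lift s to ℝ≥0 using hs0.le
    exact hausdorffMeasure_of_dimH_lt (by rw [hα]; exact_mod_cast hαs)
  obtain ⟨C, p, q, hpq, hcov, hlt'⟩ := exists_finite_cover_of_hausdorffMeasure_eq_zero hK hs0 hzero
    (ε := δ ^ s) (Real.rpow_pos_of_pos hδ0 s)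
  exact absurd (rpow_le_sum_of_cover hne hS hρ hmap (le_of_lt hδ0) hδ hs0.le hs.le _ C rfl p q hpq
    hcov) (not_le.2 hlt')

end HausdorffMeasureReal

/-! ### Premeasures at a fixed scale, and positivity of the Hausdorff measure. -/

noncomputable section

section HausdorffPre

open scoped Topology Pointwise
open Metric (ediam)

/-- The outer measure obtained from covers by sets of diameter at most `δ`, whose limit as `δ → 0`
is the `s`-dimensional Hausdorff measure. -/
def hausdorffPre (s : ℝ) (δ : ℝ≥0∞) : OuterMeasure ℝ :=
  OuterMeasure.mkMetric'.pre (fun A => ediam A ^ s) δ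

theorem hausdorffPre_le {s : ℝ} {δ : ℝ≥0∞} {A : Set ℝ} (h : ediam A ≤ δ) :
    hausdorffPre s δ A ≤ ediam A ^ s :=
  OuterMeasure.mkMetric'.pre_le h

theorem hausdorffPre_anti (s : ℝ) {δ δ' : ℝ≥0∞} (h : δ ≤ δ') (A : Set ℝ) :
    hausdorffPre s δ' A ≤ hausdorffPre s δ A :=
  OuterMeasure.mkMetric'.mono_pre _ h A

theorem tendsto_hausdorffPre (s : ℝ) (A : Set ℝ) :
    Tendsto (fun δ => hausdorffPre s δ A) (𝓝[>] 0) (𝓝 (Measure.hausdorffMeasure s A)) := by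
  have h : Measure.hausdorffMeasure s A
      = OuterMeasure.mkMetric' (fun A : Set ℝ => ediam A ^ s) A := by
    rw [Measure.hausdorffMeasure, ← Measure.coe_toOuterMeasure, Measure.mkMetric_toOuterMeasure]
    rfl
  rw [h]
  exact OuterMeasure.mkMetric'.tendsto_pre _ A

theorem hausdorffPre_le_hausdorffMeasure (s : ℝ) {δ : ℝ≥0∞} (hδ : 0 < δ) (A : Set ℝ) :
    hausdorffPre s δ A ≤ Measure.hausdorffMeasure s A :=
  ge_of_tendsto (tendsto_hausdorffPre s A) (by
    filter_upwards [Ioo_mem_nhdsGT hδ] with ε hε using hausdorffPre_anti s hε.2.le A)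

theorem ediam_affine_image_le {ρ : ℝ} (hρ : 0 ≤ ρ) (σ : ℝ) (A : Set ℝ) :
    ediam ((fun x => ρ * x + σ) '' A) ≤ ENNReal.ofReal ρ * ediam A := by
  have : LipschitzWith ρ.toNNReal (fun x => ρ * x + σ) := by
    refine LipschitzWith.of_dist_le_mul fun x y => ?_
    rw [Real.dist_eq, Real.dist_eq, Real.coe_toNNReal _ hρ, ← abs_of_nonneg hρ, ← abs_mul,
      abs_of_nonneg hρ]
    exact le_of_eq (by ring_nf)
  exact this.ediam_image_le A

/-- At a fixed scale the image of an admissible covering set must remain admissible, which is why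
the ratio may not exceed 1. -/
theorem hausdorffPre_affine_image_le {s : ℝ} (hs : 0 ≤ s) (δ : ℝ≥0∞) {ρ : ℝ} (hρ : 0 < ρ)
    (hρ1 : ρ ≤ 1) (σ : ℝ) (A : Set ℝ) :
    hausdorffPre s δ ((fun x => ρ * x + σ) '' A)
      ≤ ENNReal.ofReal ρ ^ s * hausdorffPre s δ A := by
  set c := ENNReal.ofReal ρ ^ s with hc
  have hc0 : c ≠ 0 := (ENNReal.rpow_pos (ENNReal.ofReal_pos.2 hρ) ENNReal.ofReal_ne_top).ne'
  have hct : c ≠ ⊤ := ENNReal.rpow_ne_top_of_nonneg hs ENNReal.ofReal_ne_top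
  have h : c⁻¹ • OuterMeasure.comap (fun x => ρ * x + σ) (hausdorffPre s δ)
      ≤ hausdorffPre s δ := by
    refine OuterMeasure.mkMetric'.le_pre.2 fun B hB => ?_
    have h1 := ediam_affine_image_le hρ.le σ B
    have h2 : ediam ((fun x => ρ * x + σ) '' B) ≤ δ := by
      refine h1.trans (le_trans ?_ hB)
      calc _ ≤ 1 * ediam B := by gcongr; exact ENNReal.ofReal_le_one.2 hρ1
        _ = _ := one_mul _
    simp only [smul_apply, OuterMeasure.comap_apply, smul_eq_mul]
    rw [ENNReal.inv_mul_le_iff hc0 hct]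
    calc _ ≤ ediam ((fun x => ρ * x + σ) '' B) ^ s := hausdorffPre_le h2
      _ ≤ (ENNReal.ofReal ρ * ediam B) ^ s := by gcongr
      _ = _ := ENNReal.mul_rpow_of_nonneg _ _ hs
  have h3 := h A
  simp only [smul_apply, OuterMeasure.comap_apply, smul_eq_mul] at h3
  rwa [ENNReal.inv_mul_le_iff hc0 hct] at h3

theorem hausdorffMeasure_affine_image {s : ℝ} (hs : 0 ≤ s) {ρ : ℝ} (hρ : ρ ≠ 0) (σ : ℝ)
    (A : Set ℝ) :
    Measure.hausdorffMeasure s ((fun x => ρ * x + σ) '' A)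
      = ENNReal.ofReal |ρ| ^ s * Measure.hausdorffMeasure s A := by
  have h1 : (fun x => ρ * x + σ) '' A = IsometryEquiv.addRight σ '' (ρ • A) := by
    rw [← image_smul, ← image_comp]
    rfl
  rw [h1, IsometryEquiv.hausdorffMeasure_image, Measure.hausdorffMeasure_smul₀ hs hρ,
    ENNReal.smul_def, smul_eq_mul]
  congr 1
  rw [ENNReal.coe_rpow_of_nonneg _ hs, ← Real.norm_eq_abs, ofReal_norm]
  rfl

/-- A compact set has finitely many balls of diameter at most δ covering it. Finiteness matters
because an inequality X ≤ X/2 for the premeasure X then forces X = 0, even at exponents where the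
Hausdorff measure might be infinite. -/
theorem hausdorffPre_ne_top_of_isCompact {s : ℝ} (hs : 0 ≤ s) {δ : ℝ≥0∞} (hδ : 0 < δ)
    (hδt : δ ≠ ⊤) {K : Set ℝ} (hK : IsCompact K) : hausdorffPre s δ K ≠ ⊤ := by
  obtain ⟨t, -, htf, hcov⟩ := Metric.totallyBounded_iff.1 hK.totallyBounded (δ / 2).toReal
    (ENNReal.toReal_pos (ENNReal.half_pos hδ.ne').ne' (ENNReal.div_ne_top hδt (by simp))) |>.imp
      fun t h => (⟨trivial, h⟩ : True ∧ _)
  refine ne_top_of_le_ne_top ?_ ((measure_mono hcov).trans (measure_biUnion_le _ htf.countable _))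
  have hd : ∀ x : ℝ, ediam (Metric.ball x (δ / 2).toReal) ≤ δ := fun x => by
    rw [← Metric.eball_ofReal, ENNReal.ofReal_toReal (ENNReal.div_ne_top hδt (by simp))]
    exact Metric.ediam_eball_le.trans_eq (ENNReal.mul_div_cancel (by simp) (by simp))
  have := htf.fintype
  rw [tsum_fintype]
  refine ENNReal.sum_ne_top.2 fun x _ => ?_
  exact ne_top_of_le_ne_top (ENNReal.rpow_ne_top_of_nonneg hs hδt)
    ((hausdorffPre_le (hd x)).trans (by gcongr; exact hd x))

end HausdorffPre

section

open scoped Topology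
open Metric (ediam)

/-- If every portion `K ∩ [x, y]` is covered by boundedly many similar copies of `K` of comparable
size, then the Hausdorff measure of `K` in its dimension is positive. -/
theorem hausdorffMeasure_ne_zero_of_portions {K : Set ℝ} (hK : IsCompact K) {α : ℝ≥0}
    (hα0 : 0 < α) (hα : dimH K = α) {N : ℕ} {γ : ℝ} (hγ : 0 < γ)
    (hcov : ∀ x ∈ K, ∀ y ∈ K, x < y → ∃ F : Finset (ℝ × ℝ), F.card ≤ N ∧
      (∀ f ∈ F, 0 < f.1 ∧ f.1 ≤ (y - x) / γ) ∧
      K ∩ Icc x y ⊆ ⋃ f ∈ F, (fun z => f.1 * z + f.2) '' K) :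
    Measure.hausdorffMeasure α K ≠ 0 := by
  intro h0
  have hα' : (0 : ℝ) < α := hα0
  -- The first bound keeps all covering intervals of length at most γ, so that the copies have
  -- ratios at most 1. The second makes N Σ (length/γ)^α at most 1/4, which leaves room to lower the
  -- exponent.
  set ε : ℝ := min (γ ^ (α : ℝ)) (γ ^ (α : ℝ) / (4 * (N + 1))) with hε
  have hγα : 0 < γ ^ (α : ℝ) := by positivity
  have hεpos : 0 < ε := lt_min hγα (by positivity)
  obtain ⟨C, p, q, hpq, hC, hsum⟩ :=
    exists_finite_cover_of_hausdorffMeasure_eq_zero hK hα' h0 hεpos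
  have hsmall : ∀ n ∈ C, q n - p n ≤ γ := by
    intro n hn
    have h1 : (q n - p n) ^ (α : ℝ) ≤ γ ^ (α : ℝ) :=
      (Finset.single_le_sum (f := fun n => (q n - p n) ^ (α : ℝ))
        (fun n _ => Real.rpow_nonneg (sub_pos.2 (hpq n)).le _) hn).trans
        (hsum.le.trans (min_le_left _ _))
    exact (Real.rpow_le_rpow_iff (sub_pos.2 (hpq n)).le hγ.le hα').1 h1
  set g : ℝ → ℝ := fun t => N * ∑ n ∈ C, ((q n - p n) / γ) ^ t with hg
  have hbase : ∀ n, 0 < (q n - p n) / γ := fun n => div_pos (sub_pos.2 (hpq n)) hγ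
  have hgα : g α < 1 / 2 := by
    have h1 : g α = N * ((∑ n ∈ C, (q n - p n) ^ (α : ℝ)) / γ ^ (α : ℝ)) := by
      rw [Finset.sum_div]
      exact congrArg _ (Finset.sum_congr rfl fun n _ =>
        Real.div_rpow (sub_pos.2 (hpq n)).le hγ.le _)
    have h2 : (∑ n ∈ C, (q n - p n) ^ (α : ℝ)) / γ ^ (α : ℝ) ≤ 1 / (4 * (N + 1)) := by
      rw [div_le_iff₀ hγα]
      refine (hsum.le.trans (min_le_right _ _)).trans_eq ?_
      ring
    have h3 : (N : ℝ) * (1 / (4 * (N + 1))) ≤ 1 / 4 := by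
      rw [mul_one_div, div_le_div_iff₀ (by positivity) (by norm_num)]
      linarith
    rw [h1]
    calc _ ≤ (N : ℝ) * (1 / (4 * (N + 1))) := by gcongr
      _ ≤ 1 / 4 := h3
      _ < 1 / 2 := by norm_num
  have hcont : ContinuousAt g α := ContinuousAt.mul continuousAt_const
    (tendsto_finsetSum _ fun n _ => Real.continuousAt_const_rpow (hbase n).ne')
  -- By continuity the sum is still below 1/2 at some t in (0, α). Replacing each covering interval
  -- by its copies of K gives X ≤ X/2 for the t-premeasure X of K, whence dim K ≤ t < α, a
  -- contradiction.
  obtain ⟨t, ht, ht0, htα⟩ := (((hcont.eventually (gt_mem_nhds hgα)).filter_mono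
    nhdsWithin_le_nhds).and (Ioo_mem_nhdsLT hα')).exists
  have hzero : ∀ δ : ℝ≥0∞, 0 < δ → δ ≠ ⊤ → hausdorffPre t δ K = 0 := by
    intro δ hδ hδt
    set X := hausdorffPre t δ K with hX
    have hXt : X ≠ ⊤ := hausdorffPre_ne_top_of_isCompact ht0.le hδ hδt hK
    have hpiece : ∀ n ∈ C, hausdorffPre t δ (K ∩ Icc (p n) (q n))
        ≤ ENNReal.ofReal (N * ((q n - p n) / γ) ^ t) * X := by
      intro n hn
      rcases Set.subsingleton_or_nontrivial (K ∩ Icc (p n) (q n)) with hs | hs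
      · refine (hausdorffPre_le (by rw [Metric.ediam_subsingleton hs]; exact hδ.le)).trans ?_
        rw [Metric.ediam_subsingleton hs, ENNReal.zero_rpow_of_pos ht0]
        exact zero_le
      · have hcomp : IsCompact (K ∩ Icc (p n) (q n)) := hK.inter isCompact_Icc
        have hx := hcomp.sInf_mem hs.nonempty
        have hy := hcomp.sSup_mem hs.nonempty
        set x := sInf (K ∩ Icc (p n) (q n))
        set y := sSup (K ∩ Icc (p n) (q n))
        have hsub : K ∩ Icc (p n) (q n) ⊆ K ∩ Icc x y := fun z hz =>
          ⟨hz.1, csInf_le hcomp.bddBelow hz, le_csSup hcomp.bddAbove hz⟩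
        have hxy : x < y := by
          obtain ⟨a, ha, b, hb, hab⟩ := hs
          by_contra hle
          have h1 := (hsub ha).2
          have h2 := (hsub hb).2
          exact hab (by linarith [h1.1, h1.2, h2.1, h2.2])
        obtain ⟨F, hFN, hF, hFK⟩ := hcov x hx.1 y hy.1 hxy
        have hle : (y - x) / γ ≤ (q n - p n) / γ := by
          gcongr
          · exact hy.2.2
          · exact hx.2.1
        have hle1 : (q n - p n) / γ ≤ 1 := (div_le_one hγ).2 (hsmall n hn)
        calc hausdorffPre t δ (K ∩ Icc (p n) (q n))
            ≤ hausdorffPre t δ (⋃ f ∈ F, (fun z => f.1 * z + f.2) '' K) :=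
              measure_mono (hsub.trans hFK)
          _ ≤ ∑ f ∈ F, hausdorffPre t δ ((fun z => f.1 * z + f.2) '' K) :=
              measure_biUnion_finset_le _ _
          _ ≤ ∑ f ∈ F, ENNReal.ofReal (((q n - p n) / γ) ^ t) * X := by
              refine Finset.sum_le_sum fun f hf => ?_
              have h1 := hF f hf
              refine (hausdorffPre_affine_image_le ht0.le δ h1.1 (h1.2.trans (hle.trans hle1))
                _ _).trans ?_
              rw [ENNReal.ofReal_rpow_of_nonneg h1.1.le ht0.le]
              gcongr
              · exact h1.1.le
              · exact h1.2.trans hle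
          _ = F.card * (ENNReal.ofReal (((q n - p n) / γ) ^ t) * X) := by
              rw [Finset.sum_const, nsmul_eq_mul]
          _ ≤ N * (ENNReal.ofReal (((q n - p n) / γ) ^ t) * X) := by gcongr
          _ = _ := by
              rw [ENNReal.ofReal_mul (by positivity), ENNReal.ofReal_natCast, mul_assoc]
    have hXle : X ≤ ENNReal.ofReal (1 / 2) * X := by
      calc X ≤ hausdorffPre t δ (⋃ n ∈ C, K ∩ Icc (p n) (q n)) := by
            refine measure_mono fun z hz => ?_
            obtain ⟨n, hn, hzn⟩ := mem_iUnion₂.1 (hC hz)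
            exact mem_iUnion₂.2 ⟨n, hn, hz, hzn⟩
        _ ≤ ∑ n ∈ C, hausdorffPre t δ (K ∩ Icc (p n) (q n)) := measure_biUnion_finset_le _ _
        _ ≤ ∑ n ∈ C, ENNReal.ofReal (N * ((q n - p n) / γ) ^ t) * X := Finset.sum_le_sum hpiece
        _ = ENNReal.ofReal (g t) * X := by
            rw [← Finset.sum_mul, ← ENNReal.ofReal_sum_of_nonneg, ← Finset.mul_sum]
            intro n _
            have := hbase n
            positivity
        _ ≤ _ := by gcongr
    by_contra hX0
    have h3 : ENNReal.ofReal (1 / 2) * X < 1 * X := by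
      rw [ENNReal.mul_lt_mul_iff_left hX0 hXt, ENNReal.ofReal_lt_one]
      norm_num
    rw [one_mul] at h3
    exact absurd hXle (not_le.2 h3)
  have hHt : Measure.hausdorffMeasure t K = 0 := by
    refine tendsto_nhds_unique (tendsto_hausdorffPre t K) (tendsto_const_nhds.congr' ?_)
    filter_upwards [Ioo_mem_nhdsGT one_pos] with δ hδ
    exact (hzero δ hδ.1 (hδ.2.trans ENNReal.one_lt_top).ne).symm
  lift t to ℝ≥0 using ht0.le
  have hdim : dimH K ≤ t :=
    dimH_le_of_hausdorffMeasure_ne_top (by rw [hHt]; exact ENNReal.zero_ne_top)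
  rw [hα, ENNReal.coe_le_coe] at hdim
  exact absurd htα (not_lt.2 (NNReal.coe_le_coe.2 hdim))

end

/-- `K` is covered by finitely many disjoint intervals of length at most `δ`, each containing the
image of `[0,1]` under a similarity that maps `K` into itself and whose ratio is at least `c` times
the length of the interval. -/
def HasSimilarCover (K : Set ℝ) (c δ : ℝ) : Prop :=
  ∃ (S : Finset (ℝ × ℝ)) (ρ σ : ℝ × ℝ → ℝ), (K ⊆ ⋃ I ∈ S, Icc I.1 I.2) ∧
    (∀ I ∈ S, ∀ J ∈ S, I ≠ J → Disjoint (Icc I.1 I.2) (Icc J.1 J.2)) ∧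
    ∀ I ∈ S, I.1 ≤ I.2 ∧ I.2 - I.1 ≤ δ ∧ 0 < ρ I ∧ ρ I ≤ 1 ∧ c * (I.2 - I.1) ≤ ρ I ∧
      I.1 ≤ σ I ∧ ρ I + σ I ≤ I.2 ∧ ∀ x ∈ K, ρ I * x + σ I ∈ K

/-! ### Finiteness of the Hausdorff measure, and its local upper bound. -/

section

open scoped Topology
open Metric (ediam)

variable {K : Set ℝ} {c : ℝ} {α : ℝ≥0}

theorem HasSimilarCover.sum_rpow_le_one {δ : ℝ} {S : Finset (ℝ × ℝ)} {ρ σ : ℝ × ℝ → ℝ}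
    (hK : IsCompact K)
    (hne : K.Nonempty) (hK1 : K ⊆ Icc 0 1) (hα : dimH K = α)
    (hdisj : ∀ I ∈ S, ∀ J ∈ S, I ≠ J → Disjoint (Icc I.1 I.2) (Icc J.1 J.2))
    (hS : ∀ I ∈ S, I.1 ≤ I.2 ∧ I.2 - I.1 ≤ δ ∧ 0 < ρ I ∧ ρ I ≤ 1 ∧ c * (I.2 - I.1) ≤ ρ I ∧
      I.1 ≤ σ I ∧ ρ I + σ I ≤ I.2 ∧ ∀ x ∈ K, ρ I * x + σ I ∈ K) :
    ∑ I ∈ S, ρ I ^ (α : ℝ) ≤ 1 := by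
  refine sum_rpow_le_one_of_pairwise_disjoint hK hne hα (σ := σ) (fun I hI => (hS I hI).2.2.1)
    (fun I hI => (hS I hI).2.2.2.1) (fun I hI => (hS I hI).2.2.2.2.2.2.2) fun I hI J hJ hIJ => ?_
  refine (hdisj I hI J hJ hIJ).mono ?_ ?_
  all_goals
    rintro _ ⟨x, hx, rfl⟩
    obtain ⟨hx0, hx1⟩ := hK1 hx
  · obtain ⟨-, -, h1, -, -, h2, h3, -⟩ := hS I hI
    exact ⟨by dsimp only; nlinarith, by dsimp only; nlinarith⟩
  · obtain ⟨-, -, h1, -, -, h2, h3, -⟩ := hS J hJ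
    exact ⟨by dsimp only; nlinarith, by dsimp only; nlinarith⟩

theorem HasSimilarCover.hausdorffPre_le_sum {δ : ℝ} {S : Finset (ℝ × ℝ)}
    {ρ : ℝ × ℝ → ℝ} (hc : 0 < c)
    (hcov : K ⊆ ⋃ I ∈ S, Icc I.1 I.2)
    (hS : ∀ I ∈ S, I.1 ≤ I.2 ∧ I.2 - I.1 ≤ δ ∧ 0 < ρ I ∧ c * (I.2 - I.1) ≤ ρ I) :
    ENNReal.ofReal (c ^ (α : ℝ)) * hausdorffPre α (ENNReal.ofReal δ) K
      ≤ ENNReal.ofReal (∑ I ∈ S, ρ I ^ (α : ℝ)) := by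
  have h1 : hausdorffPre α (ENNReal.ofReal δ) K
      ≤ ∑ I ∈ S, ENNReal.ofReal ((I.2 - I.1) ^ (α : ℝ)) := by
    calc _ ≤ hausdorffPre α (ENNReal.ofReal δ) (⋃ I ∈ S, Icc I.1 I.2) := measure_mono hcov
      _ ≤ ∑ I ∈ S, hausdorffPre α (ENNReal.ofReal δ) (Icc I.1 I.2) := measure_biUnion_finset_le _ _
      _ ≤ _ := Finset.sum_le_sum fun I hI => by
        obtain ⟨h1, h2, -⟩ := hS I hI
        rw [← ENNReal.ofReal_rpow_of_nonneg (sub_nonneg.2 h1) α.coe_nonneg, ← Real.ediam_Icc]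
        exact hausdorffPre_le (by rw [Real.ediam_Icc]; exact ENNReal.ofReal_le_ofReal h2)
  have hnn : ∀ I ∈ S, 0 ≤ (I.2 - I.1) ^ (α : ℝ) := fun I hI =>
    Real.rpow_nonneg (sub_nonneg.2 (hS I hI).1) _
  refine (mul_le_mul_right h1 _).trans ?_
  rw [← ENNReal.ofReal_sum_of_nonneg hnn, ← ENNReal.ofReal_mul (by positivity), Finset.mul_sum]
  refine ENNReal.ofReal_le_ofReal (Finset.sum_le_sum fun I hI => ?_)
  obtain ⟨h1, -, -, h2⟩ := hS I hI
  rw [← Real.mul_rpow hc.le (sub_nonneg.2 h1)]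
  exact Real.rpow_le_rpow (mul_nonneg hc.le (sub_nonneg.2 h1)) h2 α.coe_nonneg

/-- The copies lie in disjoint intervals, so Σ ρ^α ≤ 1, and each interval has length at most ρ/c.
Hence c^α times the premeasure is at most 1 at all small scales. -/
theorem hausdorffMeasure_ne_top_of_hasSimilarCover (hK : IsCompact K) (hne : K.Nonempty)
    (hK1 : K ⊆ Icc 0 1) (hα : dimH K = α) (hc : 0 < c)
    (h : ∀ δ, 0 < δ → HasSimilarCover K c δ) : Measure.hausdorffMeasure α K ≠ ⊤ := by
  have hcα : 0 < c ^ (α : ℝ) := by positivity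
  have hle : ENNReal.ofReal (c ^ (α : ℝ)) * Measure.hausdorffMeasure α K ≤ 1 := by
    refine le_of_tendsto (ENNReal.Tendsto.const_mul (tendsto_hausdorffPre α K)
      (Or.inr ENNReal.ofReal_ne_top)) ?_
    filter_upwards [Ioo_mem_nhdsGT one_pos] with δ hδ
    have hδt : δ ≠ ⊤ := (hδ.2.trans ENNReal.one_lt_top).ne
    obtain ⟨S, ρ, σ, hcov, hdisj, hS⟩ := h δ.toReal (ENNReal.toReal_pos hδ.1.ne' hδt)
    have h1 := HasSimilarCover.hausdorffPre_le_sum (α := α) hc hcov fun I hI =>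
      ⟨(hS I hI).1, (hS I hI).2.1, (hS I hI).2.2.1, (hS I hI).2.2.2.2.1⟩
    rw [ENNReal.ofReal_toReal hδt] at h1
    exact h1.trans (ENNReal.ofReal_le_one.2
      (HasSimilarCover.sum_rpow_le_one hK hne hK1 hα hdisj hS))
  intro htop
  rw [htop, ENNReal.mul_top (ENNReal.ofReal_pos.2 hcα).ne'] at hle
  exact absurd hle (by simp)

/-- Under similar covers of all scales, no portion of `K` has a measure that exceeds the power of
its diameter. -/
theorem hausdorffMeasure_inter_Icc_le (hK : IsCompact K) (hc : 0 < c)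
    (h0 : Measure.hausdorffMeasure α K ≠ 0) (ht : Measure.hausdorffMeasure α K ≠ ⊤)
    (h : ∀ δ, 0 < δ → HasSimilarCover K c δ) {p q : ℝ} (hp : 0 ≤ p) (hpq : p ≤ q) (hq : q ≤ 1) :
    Measure.hausdorffMeasure α (K ∩ Icc p q) ≤ ENNReal.ofReal ((q - p) ^ (α : ℝ)) := by
  set H := Measure.hausdorffMeasure (α : ℝ) K with hH
  set h' := Measure.hausdorffMeasure (α : ℝ) (K ∩ Icc p q) with hh'
  set E := ENNReal.ofReal ((q - p) ^ (α : ℝ)) with hE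
  have hh't : h' ≠ ⊤ := ne_top_of_le_ne_top ht (measure_mono inter_subset_left)
  -- Take s = Σ ρ^α and put a copy P of [p, q] in each cover interval. Covering K by these copies
  -- costs at most sE, plus the Hausdorff measure of the remainder; by disjointness the copies carry
  -- mass at least s h'. Adding the two estimates gives the first inequality, and the second keeps s
  -- away from 0.
  have key : ∀ δ : ℝ≥0∞, 0 < δ → δ ≤ 1 → ∃ s : ℝ≥0∞, s ≠ ⊤ ∧
      hausdorffPre α δ K + s * h' ≤ H + s * E ∧
      ENNReal.ofReal (c ^ (α : ℝ)) * hausdorffPre α δ K ≤ s := by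
    intro δ hδ hδ1
    have hδt : δ ≠ ⊤ := (hδ1.trans_lt ENNReal.one_lt_top).ne
    obtain ⟨S, ρ, σ, hcov, hdisj, hS⟩ := h δ.toReal (ENNReal.toReal_pos hδ.ne' hδt)
    refine ⟨ENNReal.ofReal (∑ I ∈ S, ρ I ^ (α : ℝ)), ENNReal.ofReal_ne_top, ?_, ?_⟩
    · set P : ℝ × ℝ → Set ℝ := fun I => (fun x => ρ I * x + σ I) '' Icc p q with hP
      have hPsub : ∀ I ∈ S, P I ⊆ Icc I.1 I.2 := by
        rintro I hI _ ⟨x, hx, rfl⟩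
        obtain ⟨-, -, h1, -, -, h2, h3, -⟩ := hS I hI
        obtain ⟨hx1, hx2⟩ := hx
        exact ⟨by dsimp only; nlinarith, by dsimp only; nlinarith⟩
      have hPm : ∀ I, MeasurableSet (P I) := fun I =>
        (isCompact_Icc.image (by fun_prop)).measurableSet
      have hPd : ∀ I ∈ S, ediam (P I) ≤ ENNReal.ofReal (ρ I * (q - p)) := by
        intro I hI
        have h1 := (hS I hI).2.2.1.le
        refine (ediam_affine_image_le h1 _ _).trans ?_
        rw [Real.ediam_Icc, ENNReal.ofReal_mul h1]
      have hρδ : ∀ I ∈ S, ρ I ≤ δ.toReal := by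
        intro I hI
        obtain ⟨-, h1, -, -, -, h2, h3, -⟩ := hS I hI
        linarith
      have h1 : hausdorffPre α δ (⋃ I ∈ S, P I)
          ≤ ENNReal.ofReal (∑ I ∈ S, ρ I ^ (α : ℝ)) * E := by
        rw [ENNReal.ofReal_sum_of_nonneg fun I hI => Real.rpow_nonneg (hS I hI).2.2.1.le _,
          Finset.sum_mul]
        refine (measure_biUnion_finset_le _ _).trans (Finset.sum_le_sum fun I hI => ?_)
        have h0 := (hS I hI).2.2.1.le
        refine (hausdorffPre_le ((hPd I hI).trans ?_)).trans ?_
        · rw [← ENNReal.ofReal_toReal hδt]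
          refine ENNReal.ofReal_le_ofReal (le_trans ?_ (hρδ I hI))
          exact mul_le_of_le_one_right h0 (by linarith)
        · rw [hE, ← ENNReal.ofReal_mul (Real.rpow_nonneg h0 _),
            ← Real.mul_rpow h0 (by linarith),
            ← ENNReal.ofReal_rpow_of_nonneg (mul_nonneg h0 (by linarith)) α.coe_nonneg]
          gcongr
          exact hPd I hI
      have h2 : ENNReal.ofReal (∑ I ∈ S, ρ I ^ (α : ℝ)) * h'
          ≤ Measure.hausdorffMeasure α (K ∩ ⋃ I ∈ S, P I) := by
        rw [ENNReal.ofReal_sum_of_nonneg fun I hI => Real.rpow_nonneg (hS I hI).2.2.1.le _,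
          Finset.sum_mul, inter_iUnion₂, measure_biUnion_finset]
        · refine Finset.sum_le_sum fun I hI => ?_
          obtain ⟨-, -, h1, -, -, -, -, h2⟩ := hS I hI
          rw [← ENNReal.ofReal_rpow_of_nonneg h1.le α.coe_nonneg, ← abs_of_pos h1, hh',
            ← hausdorffMeasure_affine_image α.coe_nonneg h1.ne' (σ I)]
          refine measure_mono ?_
          rintro _ ⟨x, ⟨hxK, hx⟩, rfl⟩
          exact ⟨h2 x hxK, x, hx, rfl⟩
        · intro I hI J hJ hIJ
          exact (hdisj I hI J hJ hIJ).mono (inter_subset_right.trans (hPsub I hI))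
            (inter_subset_right.trans (hPsub J hJ))
        · exact fun I _ => hK.measurableSet.inter (hPm I)
      have hm : MeasurableSet (⋃ I ∈ S, P I) := S.measurableSet_biUnion fun I _ => hPm I
      calc _ ≤ hausdorffPre α δ (K ∩ ⋃ I ∈ S, P I) + hausdorffPre α δ (K \ ⋃ I ∈ S, P I)
            + ENNReal.ofReal (∑ I ∈ S, ρ I ^ (α : ℝ)) * h' := by
            gcongr
            conv_lhs => rw [← inter_union_sdiff K (⋃ I ∈ S, P I)]
            exact measure_union_le _ _
        _ ≤ ENNReal.ofReal (∑ I ∈ S, ρ I ^ (α : ℝ)) * E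
            + Measure.hausdorffMeasure α (K \ ⋃ I ∈ S, P I)
            + Measure.hausdorffMeasure α (K ∩ ⋃ I ∈ S, P I) := by
            gcongr
            · exact (measure_mono inter_subset_right).trans h1
            · exact hausdorffPre_le_hausdorffMeasure _ hδ _
        _ = H + ENNReal.ofReal (∑ I ∈ S, ρ I ^ (α : ℝ)) * E := by
            rw [hH, ← measure_inter_add_sdiff K hm]
            ring
    · have h1 := HasSimilarCover.hausdorffPre_le_sum (α := α) hc hcov fun I hI =>
        ⟨(hS I hI).1, (hS I hI).2.1, (hS I hI).2.2.1, (hS I hI).2.2.2.2.1⟩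
      rwa [ENNReal.ofReal_toReal hδt] at h1
  by_contra hlt
  push Not at hlt
  -- If h' > E, then `key` bounds (1 + κ) times the premeasure by H with κ > 0. Letting δ tend to 0
  -- gives H + Hκ ≤ H, which is impossible for 0 < H < ∞.
  set κ := ENNReal.ofReal (c ^ (α : ℝ)) * (h' - E) with hκ
  have hκ0 : κ ≠ 0 := mul_ne_zero (ENNReal.ofReal_pos.2 (by positivity)).ne'
    (tsub_pos_of_lt hlt).ne'
  have hle : ∀ᶠ δ in 𝓝[>] (0 : ℝ≥0∞),
      hausdorffPre α δ K + hausdorffPre α δ K * κ ≤ H := by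
    filter_upwards [Ioo_mem_nhdsGT one_pos] with δ hδ
    obtain ⟨s, hst, h1, h2⟩ := key δ hδ.1 hδ.2.le
    have hsE : s * E ≠ ⊤ := ENNReal.mul_ne_top hst ENNReal.ofReal_ne_top
    refine (ENNReal.add_le_add_iff_right hsE).1 (le_trans ?_ h1)
    have h3 : s * h' = s * (h' - E) + s * E := by
      rw [← mul_add, tsub_add_cancel_of_le hlt.le]
    rw [h3, ← add_assoc]
    refine add_le_add_left (add_le_add_right ?_ _) _
    calc hausdorffPre α δ K * κ
        = ENNReal.ofReal (c ^ (α : ℝ)) * hausdorffPre α δ K * (h' - E) := by rw [hκ]; ring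
      _ ≤ _ := by gcongr
  have hκt : κ ≠ ⊤ := ENNReal.mul_ne_top ENNReal.ofReal_ne_top
    (ne_top_of_le_ne_top hh't tsub_le_self)
  have hlim := (tendsto_hausdorffPre α K).add
    (ENNReal.Tendsto.mul_const (b := κ) (tendsto_hausdorffPre α K) (Or.inr hκt))
  have hfin := le_of_tendsto hlim hle
  have : H + 0 < H + H * κ := ENNReal.add_lt_add_left ht (pos_iff_ne_zero.2 (mul_ne_zero h0 hκ0))
  rw [add_zero] at this
  exact absurd hfin (not_le.2 this)

end

end

/-! ### Word maps, the attractor, and bounded components of open sets of the line. -/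

noncomputable section

namespace LinearIFS

variable {m : ℕ} {Φ : LinearIFS m} {K : Set ℝ} {M : ℕ → Finset (List (Fin m))}

section Words

theorem wordMap_append (u v : List (Fin m)) (x : ℝ) :
    Φ.wordMap (u ++ v) x = Φ.wordMap u (Φ.wordMap v x) := by
  induction u with
  | nil => rfl
  | cons j u ih => exact congrArg (Φ.map j) ih

/-- The maps `S_w` are similarities whose ratios decay exponentially in the length of `w`. -/
theorem exists_wordMap_eq (Φ : LinearIFS m) : ∃ r : ℝ, 0 < r ∧ r < 1 ∧ ∀ w : List (Fin m),
    ∃ ρ : ℝ, 0 < ρ ∧ ρ ≤ r ^ w.length ∧ ∀ x, Φ.wordMap w x = ρ * x + Φ.wordMap w 0 := by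
  obtain ⟨r, hr0, hr1, hr⟩ : ∃ r : ℝ, 0 < r ∧ r < 1 ∧ ∀ j, Φ.ratio j ≤ r := by
    rcases isEmpty_or_nonempty (Fin m) with h | h
    · exact ⟨1 / 2, by norm_num, by norm_num, fun j => h.elim j⟩
    · obtain ⟨i, hi⟩ := Finite.exists_max Φ.ratio
      exact ⟨Φ.ratio i, Φ.ratio_pos i, Φ.ratio_lt_one i, hi⟩
  refine ⟨r, hr0, hr1, fun w => ?_⟩
  induction w with
  | nil => exact ⟨1, one_pos, by simp, fun x => by simp [wordMap]⟩
  | cons j w ih =>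
    obtain ⟨ρ, h0, h1, h2⟩ := ih
    refine ⟨Φ.ratio j * ρ, mul_pos (Φ.ratio_pos j) h0, ?_, fun x => ?_⟩
    · rw [List.length_cons, pow_succ']
      exact mul_le_mul (hr j) h1 h0.le hr0.le
    · simp only [wordMap, Function.comp_apply, map]
      rw [h2 x]
      ring

theorem wordMap_strictMono (w : List (Fin m)) : StrictMono (Φ.wordMap w) := by
  obtain ⟨r, -, -, h⟩ := Φ.exists_wordMap_eq
  obtain ⟨ρ, h0, -, h2⟩ := h w
  intro x y hxy
  rw [h2 x, h2 y]
  gcongr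

theorem UnitIntervalInvariant.map_mem (h : Φ.UnitIntervalInvariant) (j : Fin m) {x : ℝ}
    (hx : x ∈ Icc (0 : ℝ) 1) : Φ.map j x ∈ Icc (0 : ℝ) 1 := by
  have h1 : MapsTo (Φ.map j) (closure (Ioo 0 1)) (closure (Ioo 0 1)) :=
    (mapsTo_iff_image_subset.2 (h j)).closure (by unfold map; fun_prop)
  rw [closure_Ioo zero_ne_one] at h1
  exact h1 hx

theorem UnitIntervalInvariant.wordMap_mem (h : Φ.UnitIntervalInvariant) (w : List (Fin m)) {x : ℝ}
    (hx : x ∈ Icc (0 : ℝ) 1) : Φ.wordMap w x ∈ Icc (0 : ℝ) 1 := by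
  induction w with
  | nil => exact hx
  | cons j w ih => exact h.map_mem j ih

theorem IsAttractor.wordMap_mem (hK : Φ.IsAttractor K) (w : List (Fin m)) {x : ℝ} (hx : x ∈ K) :
    Φ.wordMap w x ∈ K := by
  induction w with
  | nil => exact hx
  | cons j w ih =>
    rw [hK.eq_iUnion]
    exact mem_iUnion.2 ⟨j, _, ih, rfl⟩

theorem IsAttractor.exists_word (hK : Φ.IsAttractor K) (N : ℕ) {x : ℝ} (hx : x ∈ K) :
    ∃ w : List (Fin m), w.length = N ∧ ∃ y ∈ K, Φ.wordMap w y = x := by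
  induction N generalizing x with
  | zero => exact ⟨[], rfl, x, hx, rfl⟩
  | succ N ih =>
    rw [hK.eq_iUnion] at hx
    obtain ⟨j, y, hy, rfl⟩ := mem_iUnion.1 hx
    obtain ⟨w, hw, z, hz, rfl⟩ := ih hy
    exact ⟨j :: w, by simp [hw], z, hz, rfl⟩

/-- Each extreme point of K is the image of a point of K under a contraction preserving [0,1]. An
extreme point outside [0,1] would have to be mapped strictly closer to [0,1] than itself. -/
theorem IsAttractor.subset_Icc (hK : Φ.IsAttractor K) (h : Φ.UnitIntervalInvariant) :
    K ⊆ Icc 0 1 := by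
  have hmax : sSup K ≤ 1 := by
    have h1 := hK.isCompact.sSup_mem hK.nonempty
    have h2 := h1
    rw [hK.eq_iUnion] at h2
    obtain ⟨j, y, hy, hjy⟩ := mem_iUnion.1 h2
    have h3 : y ≤ sSup K := le_csSup hK.isCompact.bddAbove hy
    have h4 := (h.map_mem j (right_mem_Icc.2 zero_le_one)).2
    have h5 := Φ.ratio_pos j
    have h6 := Φ.ratio_lt_one j
    rw [← hK.eq_iUnion] at hjy
    simp only [map] at h4 hjy
    by_contra hlt
    nlinarith
  have hmin : 0 ≤ sInf K := by
    have h1 := hK.isCompact.sInf_mem hK.nonempty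
    have h2 := h1
    rw [hK.eq_iUnion] at h2
    obtain ⟨j, y, hy, hjy⟩ := mem_iUnion.1 h2
    have h3 : sInf K ≤ y := csInf_le hK.isCompact.bddBelow hy
    have h4 := (h.map_mem j (left_mem_Icc.2 zero_le_one)).1
    have h5 := Φ.ratio_pos j
    have h6 := Φ.ratio_lt_one j
    rw [← hK.eq_iUnion] at hjy
    simp only [map] at h4 hjy
    by_contra hlt
    nlinarith
  exact fun x hx => ⟨hmin.trans (csInf_le hK.isCompact.bddBelow hx),
    (le_csSup hK.isCompact.bddAbove hx).trans hmax⟩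

/-- The iterates of any point of K stay in the closed set K and converge to the fixed point. -/
theorem IsAttractor.mem_of_map_eq (hK : Φ.IsAttractor K) {j : Fin m} {x : ℝ}
    (hx : Φ.map j x = x) : x ∈ K := by
  obtain ⟨y, hy⟩ := hK.nonempty
  set u : ℕ → ℝ := fun n => Φ.ratio j ^ n * (y - x) + x with hu
  have hmem : ∀ n, u n ∈ K := by
    intro n
    induction n with
    | zero => simpa [hu] using hy
    | succ n ih =>
      rw [hK.eq_iUnion]
      refine mem_iUnion.2 ⟨j, u n, ih, ?_⟩
      simp only [map] at hx
      simp only [hu, map]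
      rw [pow_succ']
      linear_combination hx
  have hlim : Tendsto u atTop (nhds (0 * (y - x) + x)) :=
    ((tendsto_pow_atTop_nhds_zero_of_lt_one (Φ.ratio_pos j).le
      (Φ.ratio_lt_one j)).mul_const _).add_const _
  rw [zero_mul, zero_add] at hlim
  exact hK.isCompact.isClosed.mem_of_tendsto hlim (Eventually.of_forall hmem)

end Words

end LinearIFS

section Components

/-- `(a, b)` is a bounded connected component of `U`. -/
structure IsComponentInterval (U : Set ℝ) (a b : ℝ) : Prop where
  lt : a < b
  subset : Ioo a b ⊆ U
  left_notMem : a ∉ U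
  right_notMem : b ∉ U

variable {U : Set ℝ} {a b a' b' x : ℝ}

theorem IsComponentInterval.connectedComponentIn_eq (h : IsComponentInterval U a b)
    (hx : x ∈ Ioo a b) : connectedComponentIn U x = Ioo a b := by
  refine Subset.antisymm (fun y hy => ?_)
    (isPreconnected_Ioo.subset_connectedComponentIn hx h.subset)
  have hc := (isPreconnected_connectedComponentIn (F := U) (x := x)).ordConnected.out
  have hxc := mem_connectedComponentIn (h.subset hx)
  have hsub := connectedComponentIn_subset U x
  by_contra hn
  rw [mem_Ioo, not_and_or, not_lt, not_lt] at hn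
  rcases hn with hn | hn
  · exact h.left_notMem (hsub (hc hy hxc ⟨hn, hx.1.le⟩))
  · exact h.right_notMem (hsub (hc hxc hy ⟨hx.2.le, hn⟩))

theorem exists_isComponentInterval (hU : IsOpen U) (hb : Bornology.IsBounded U) (hx : x ∈ U) :
    ∃ a b, IsComponentInterval U a b ∧ x ∈ Ioo a b := by
  set C := connectedComponentIn U x with hC
  have hxC : x ∈ C := mem_connectedComponentIn hx
  have hCo : IsOpen C := hU.connectedComponentIn
  have hCU : C ⊆ U := connectedComponentIn_subset U x
  have hCb := hb.subset hCU
  have hconn : IsConnected C := ⟨⟨x, hxC⟩, isPreconnected_connectedComponentIn⟩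
  have hsub : Ioo (sInf C) (sSup C) ⊆ C :=
    hconn.Ioo_csInf_csSup_subset hCb.bddBelow hCb.bddAbove
  have hl : sInf C ∉ C := fun h => by
    obtain ⟨ε, hε, hεC⟩ := Metric.isOpen_iff.1 hCo _ h
    have := csInf_le hCb.bddBelow (hεC (show sInf C - ε / 2 ∈ _ by
      rw [Metric.mem_ball, Real.dist_eq, abs_lt]; constructor <;> linarith))
    linarith
  have hr : sSup C ∉ C := fun h => by
    obtain ⟨ε, hε, hεC⟩ := Metric.isOpen_iff.1 hCo _ h
    have := le_csSup hCb.bddAbove (hεC (show sSup C + ε / 2 ∈ _ by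
      rw [Metric.mem_ball, Real.dist_eq, abs_lt]; constructor <;> linarith))
    linarith
  have hxl : sInf C < x := (csInf_le hCb.bddBelow hxC).lt_of_ne fun h => hl (h ▸ hxC)
  have hxr : x < sSup C := (le_csSup hCb.bddAbove hxC).lt_of_ne fun h => hr (h ▸ hxC)
  have hnot : ∀ y ∈ closure C, y ∈ U → y ∈ C := by
    intro y hy hyU
    obtain ⟨z, hzy, hzC⟩ := mem_closure_iff.1 hy _ hU.connectedComponentIn
      (mem_connectedComponentIn hyU)
    have h1 := connectedComponentIn_eq hzC
    have h2 := connectedComponentIn_eq hzy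
    rw [hC, h1, ← h2]
    exact mem_connectedComponentIn hyU
  exact ⟨sInf C, sSup C, ⟨hxl.trans hxr, hsub.trans hCU,
    fun h => hl (hnot _ (csInf_mem_closure ⟨x, hxC⟩ hCb.bddBelow) h),
    fun h => hr (hnot _ (csSup_mem_closure ⟨x, hxC⟩ hCb.bddAbove) h)⟩, hxl, hxr⟩

theorem IsComponentInterval.subset_of_mem (h : IsComponentInterval U a b) {c d : ℝ}
    (hx : x ∈ Ioo a b) (hxc : x ∈ Ioo c d) (hcd : Ioo c d ⊆ U) : a ≤ c ∧ d ≤ b := by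
  constructor
  · by_contra hlt
    push Not at hlt
    exact h.left_notMem (hcd ⟨hlt, hx.1.trans hxc.2⟩)
  · by_contra hlt
    push Not at hlt
    exact h.right_notMem (hcd ⟨hxc.1.trans hx.2, hlt⟩)

theorem IsComponentInterval.eq_or_le (h : IsComponentInterval U a b)
    (h' : IsComponentInterval U a' b') : (a = a' ∧ b = b') ∨ b ≤ a' ∨ b' ≤ a := by
  by_cases h1 : b ≤ a'
  · exact Or.inr (Or.inl h1)
  by_cases h2 : b' ≤ a
  · exact Or.inr (Or.inr h2)
  push Not at h1 h2
  obtain ⟨x, hx1, hx2⟩ := exists_between (max_lt (lt_min h.lt h2) (lt_min h1 h'.lt))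
  rw [max_lt_iff] at hx1
  rw [lt_min_iff] at hx2
  have e1 := h.subset_of_mem (x := x) ⟨hx1.1, hx2.1⟩ ⟨hx1.2, hx2.2⟩ h'.subset
  have e2 := h'.subset_of_mem (x := x) ⟨hx1.2, hx2.2⟩ ⟨hx1.1, hx2.1⟩ h.subset
  exact Or.inl ⟨le_antisymm e1.1 e2.1, le_antisymm e2.2 e1.2⟩

end Components

end

/-! ### Geometry of islands: endpoints, ancestors, lakes and shrinking lengths. -/

noncomputable section

namespace LinearIFS

/-- A system of generalized finite type whose first map fixes `0` and whose last map fixes `1`. -/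
structure IsNormalized {n : ℕ} (Φ : LinearIFS (n + 2)) (K : Set ℝ)
    (M : ℕ → Finset (List (Fin (n + 2)))) : Prop where
  isAttractor : Φ.IsAttractor K
  map_zero : Φ.map 0 0 = 0
  map_one : Φ.map (Fin.last (n + 1)) 1 = 1
  finiteType : Φ.GeneralizedFiniteType M

/-- `[a, b]` is a `k`-th generation island. -/
abbrev IsIsland {m : ℕ} (Φ : LinearIFS m) (M : ℕ → Finset (List (Fin m))) (k : ℕ) (a b : ℝ) :
    Prop :=
  IsComponentInterval (Φ.openUnion M k) a b

variable {n : ℕ} {Φ : LinearIFS (n + 2)} {K : Set ℝ} {M : ℕ → Finset (List (Fin (n + 2)))}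
  {k : ℕ} {a b a' b' x : ℝ} {f : ℝ → ℝ}

namespace IsNormalized

theorem zero_mem (h : IsNormalized Φ K M) : (0 : ℝ) ∈ K := h.isAttractor.mem_of_map_eq h.map_zero

theorem one_mem (h : IsNormalized Φ K M) : (1 : ℝ) ∈ K := h.isAttractor.mem_of_map_eq h.map_one

theorem subset_Icc (h : IsNormalized Φ K M) : K ⊆ Icc 0 1 :=
  h.isAttractor.subset_Icc h.finiteType.invariant

theorem vertex_apply (_ : IsNormalized Φ K M) (hf : f ∈ Φ.vertexMaps M k) (x : ℝ) :
    f x = (f 1 - f 0) * x + f 0 := by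
  obtain ⟨w, -, rfl⟩ := hf
  obtain ⟨r, -, -, hr⟩ := Φ.exists_wordMap_eq
  obtain ⟨ρ, -, -, h2⟩ := hr w
  rw [h2 x, h2 1]
  ring

theorem vertex_lt (_ : IsNormalized Φ K M) (hf : f ∈ Φ.vertexMaps M k) : f 0 < f 1 := by
  obtain ⟨w, -, rfl⟩ := hf
  exact wordMap_strictMono w one_pos

theorem vertex_nonneg (h : IsNormalized Φ K M) (hf : f ∈ Φ.vertexMaps M k) : 0 ≤ f 0 := by
  obtain ⟨w, -, rfl⟩ := hf
  exact (h.finiteType.invariant.wordMap_mem w (left_mem_Icc.2 zero_le_one)).1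

theorem vertex_le_one (h : IsNormalized Φ K M) (hf : f ∈ Φ.vertexMaps M k) : f 1 ≤ 1 := by
  obtain ⟨w, -, rfl⟩ := hf
  exact (h.finiteType.invariant.wordMap_mem w (right_mem_Icc.2 zero_le_one)).2

theorem vertex_mem (h : IsNormalized Φ K M) (hf : f ∈ Φ.vertexMaps M k) (hx : x ∈ K) :
    f x ∈ K := by
  obtain ⟨w, -, rfl⟩ := hf
  exact h.isAttractor.wordMap_mem w hx

theorem vertex_mem_Icc (h : IsNormalized Φ K M) (hf : f ∈ Φ.vertexMaps M k)
    (hx : x ∈ Icc (0 : ℝ) 1) : f x ∈ Icc (f 0) (f 1) := by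
  rw [h.vertex_apply hf x]
  have := h.vertex_lt hf
  exact ⟨by nlinarith [hx.1], by nlinarith [hx.2]⟩

theorem vertex_image_Ioo (h : IsNormalized Φ K M) (hf : f ∈ Φ.vertexMaps M k) :
    f '' Ioo 0 1 = Ioo (f 0) (f 1) := by
  have hlt := sub_pos.2 (h.vertex_lt hf)
  ext y
  constructor
  · rintro ⟨x, hx, rfl⟩
    rw [h.vertex_apply hf x]
    exact ⟨by nlinarith [hx.1], by nlinarith [hx.2]⟩
  · rintro ⟨h1, h2⟩
    refine ⟨(y - f 0) / (f 1 - f 0), ⟨div_pos (by linarith) hlt, ?_⟩, ?_⟩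
    · rw [div_lt_one hlt]; linarith
    · rw [h.vertex_apply hf]
      field_simp
      ring

theorem mem_openUnion (h : IsNormalized Φ K M) :
    x ∈ Φ.openUnion M k ↔ ∃ f ∈ Φ.vertexMaps M k, f 0 < x ∧ x < f 1 := by
  simp only [openUnion, mem_iUnion, exists_prop]
  refine exists_congr fun f => and_congr_right fun hf => ?_
  rw [h.vertex_image_Ioo hf]
  rfl

theorem Ioo_subset_openUnion (h : IsNormalized Φ K M) (hf : f ∈ Φ.vertexMaps M k) :
    Ioo (f 0) (f 1) ⊆ Φ.openUnion M k :=
  fun _ hx => h.mem_openUnion.2 ⟨f, hf, hx⟩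

theorem isOpen_openUnion (h : IsNormalized Φ K M) (k : ℕ) : IsOpen (Φ.openUnion M k) :=
  isOpen_biUnion fun f hf => by
    rw [h.vertex_image_Ioo hf]
    exact isOpen_Ioo

theorem openUnion_subset (h : IsNormalized Φ K M) (k : ℕ) : Φ.openUnion M k ⊆ Ioo 0 1 := by
  intro x hx
  obtain ⟨f, hf, h1, h2⟩ := h.mem_openUnion.1 hx
  exact ⟨(h.vertex_nonneg hf).trans_lt h1, h2.trans_le (h.vertex_le_one hf)⟩

theorem isBounded_openUnion (h : IsNormalized Φ K M) (k : ℕ) :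
    Bornology.IsBounded (Φ.openUnion M k) :=
  (Metric.isBounded_Ioo 0 1).subset (h.openUnion_subset k)

theorem openUnion_antitone (h : IsNormalized Φ K M) : Antitone (Φ.openUnion M) :=
  antitone_nat_of_succ_le h.finiteType.nested

theorem vertexMaps_finite (_ : IsNormalized Φ K M) (k : ℕ) : (Φ.vertexMaps M k).Finite :=
  (M k).finite_toSet.image _

theorem exists_vertex_of_word (h : IsNormalized Φ K M) (k : ℕ) {w : List (Fin (n + 2))}
    (hw : maxLength (M k) < w.length) : ∃ f ∈ Φ.vertexMaps M k, ∃ v : List (Fin (n + 2)),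
      Φ.wordMap w = f ∘ Φ.wordMap v := by
  obtain ⟨u, hu, v, rfl⟩ := h.finiteType.indexSets.exists_prefix k w hw
  exact ⟨_, ⟨u, hu, rfl⟩, v, funext fun x => wordMap_append u v x⟩

theorem exists_vertex (h : IsNormalized Φ K M) (k : ℕ) (hx : x ∈ K) :
    ∃ f ∈ Φ.vertexMaps M k, ∃ y ∈ K, f y = x := by
  obtain ⟨w, hw, y, hy, rfl⟩ := h.isAttractor.exists_word (maxLength (M k) + 1) hx
  obtain ⟨f, hf, v, hv⟩ := h.exists_vertex_of_word k (w := w) (by omega)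
  exact ⟨f, hf, _, h.isAttractor.wordMap_mem v hy, by rw [hv]; rfl⟩

theorem mem_islands (h : IsNormalized Φ K M) {I : Set ℝ} :
    I ∈ Φ.islands M k ↔ ∃ a b, Φ.IsIsland M k a b ∧ I = Icc a b := by
  constructor
  · rintro ⟨x, hx, rfl⟩
    obtain ⟨a, b, hab, hxab⟩ :=
      exists_isComponentInterval (h.isOpen_openUnion k) (h.isBounded_openUnion k) hx
    exact ⟨a, b, hab, by rw [hab.connectedComponentIn_eq hxab, closure_Ioo hab.lt.ne]⟩
  · rintro ⟨a, b, hab, rfl⟩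
    obtain ⟨x, hx⟩ := exists_between hab.lt
    exact ⟨x, hab.subset hx, by rw [hab.connectedComponentIn_eq hx, closure_Ioo hab.lt.ne]⟩

theorem Icc_mem_islands (h : IsNormalized Φ K M) (hab : a ≤ b) :
    Icc a b ∈ Φ.islands M k ↔ Φ.IsIsland M k a b := by
  rw [h.mem_islands]
  constructor
  · rintro ⟨c, d, hcd, he⟩
    obtain ⟨rfl, rfl⟩ := (Icc_eq_Icc_iff hab).1 he
    exact hcd
  · exact fun hI => ⟨a, b, hI, rfl⟩

theorem exists_island_of_vertex (h : IsNormalized Φ K M) (hf : f ∈ Φ.vertexMaps M k) :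
    ∃ a b, Φ.IsIsland M k a b ∧ a ≤ f 0 ∧ f 1 ≤ b := by
  obtain ⟨x, hx⟩ := exists_between (h.vertex_lt hf)
  have hsub := h.Ioo_subset_openUnion hf
  obtain ⟨a, b, hab, hxab⟩ :=
    exists_isComponentInterval (h.isOpen_openUnion k) (h.isBounded_openUnion k) (hsub hx)
  exact ⟨a, b, hab, hab.subset_of_mem hxab hx hsub⟩

/-- Finitely many vertex intervals cover the open island; if the leftmost started beyond `a`, points
just to the right of `a` would be uncovered. -/
theorem exists_vertex_left (h : IsNormalized Φ K M) (hab : Φ.IsIsland M k a b) :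
    ∃ f ∈ Φ.vertexMaps M k, f 0 = a ∧ f 1 ≤ b := by
  have hmem : ∀ x ∈ Ioo a b, ∃ f ∈ Φ.vertexMaps M k, (a ≤ f 0 ∧ f 1 ≤ b) ∧ f 0 < x := by
    intro x hx
    obtain ⟨f, hf, h1, h2⟩ := h.mem_openUnion.1 (hab.subset hx)
    exact ⟨f, hf, hab.subset_of_mem hx ⟨h1, h2⟩ (h.Ioo_subset_openUnion hf), h1⟩
  obtain ⟨x, hx⟩ := exists_between hab.lt
  obtain ⟨f₀, hf₀, hf₀', -⟩ := hmem x hx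
  obtain ⟨f, ⟨hf, hfa, hfb⟩, hmin⟩ :=
    Set.exists_min_image {f | f ∈ Φ.vertexMaps M k ∧ a ≤ f 0 ∧ f 1 ≤ b} (fun f => f 0)
      ((h.vertexMaps_finite k).subset fun f hf => hf.1) ⟨f₀, hf₀, hf₀'⟩
  refine ⟨f, hf, le_antisymm ?_ hfa, hfb⟩
  by_contra hlt
  push Not at hlt
  have hf1 := h.vertex_lt hf
  obtain ⟨y, hy⟩ := exists_between hlt
  obtain ⟨g, hg, hg', hgy⟩ := hmem y ⟨hy.1, by linarith [hy.2]⟩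
  have := hmin g ⟨hg, hg'⟩
  linarith [hy.2]

theorem exists_vertex_right (h : IsNormalized Φ K M) (hab : Φ.IsIsland M k a b) :
    ∃ f ∈ Φ.vertexMaps M k, f 1 = b ∧ a ≤ f 0 := by
  have hmem : ∀ x ∈ Ioo a b, ∃ f ∈ Φ.vertexMaps M k, (a ≤ f 0 ∧ f 1 ≤ b) ∧ x < f 1 := by
    intro x hx
    obtain ⟨f, hf, h1, h2⟩ := h.mem_openUnion.1 (hab.subset hx)
    exact ⟨f, hf, hab.subset_of_mem hx ⟨h1, h2⟩ (h.Ioo_subset_openUnion hf), h2⟩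
  obtain ⟨x, hx⟩ := exists_between hab.lt
  obtain ⟨f₀, hf₀, hf₀', -⟩ := hmem x hx
  obtain ⟨f, ⟨hf, hfa, hfb⟩, hmax⟩ :=
    Set.exists_max_image {f | f ∈ Φ.vertexMaps M k ∧ a ≤ f 0 ∧ f 1 ≤ b} (fun f => f 1)
      ((h.vertexMaps_finite k).subset fun f hf => hf.1) ⟨f₀, hf₀, hf₀'⟩
  refine ⟨f, hf, le_antisymm hfb ?_, hfa⟩
  by_contra hlt
  push Not at hlt
  have hf1 := h.vertex_lt hf
  obtain ⟨y, hy⟩ := exists_between hlt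
  obtain ⟨g, hg, hg', hgy⟩ := hmem y ⟨by linarith [hy.1], hy.2⟩
  have := hmax g ⟨hg, hg'⟩
  linarith [hy.1]

theorem left_mem (h : IsNormalized Φ K M) (hab : Φ.IsIsland M k a b) : a ∈ K := by
  obtain ⟨f, hf, rfl, -⟩ := h.exists_vertex_left hab
  exact h.vertex_mem hf h.zero_mem

theorem right_mem (h : IsNormalized Φ K M) (hab : Φ.IsIsland M k a b) : b ∈ K := by
  obtain ⟨f, hf, rfl, -⟩ := h.exists_vertex_right hab
  exact h.vertex_mem hf h.one_mem

theorem mem_islandVertices (h : IsNormalized Φ K M) :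
    f ∈ Φ.islandVertices M k (Icc a b) ↔ f ∈ Φ.vertexMaps M k ∧ a ≤ f 0 ∧ f 1 ≤ b := by
  refine and_congr_right fun hf => ⟨fun hs => ?_, ?_⟩
  · exact ⟨(hs ⟨0, left_mem_Icc.2 zero_le_one, rfl⟩).1,
      (hs ⟨1, right_mem_Icc.2 zero_le_one, rfl⟩).2⟩
  · rintro ⟨h1, h2⟩ _ ⟨x, hx, rfl⟩
    have := h.vertex_mem_Icc hf hx
    exact ⟨h1.trans this.1, this.2.trans h2⟩

/-- The portion of `K` in an island is the union of the images of `K` under its vertices. -/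
theorem mem_iff_of_mem_island (h : IsNormalized Φ K M) (hab : Φ.IsIsland M k a b)
    (hx : x ∈ Icc a b) :
    x ∈ K ↔ ∃ f ∈ Φ.islandVertices M k (Icc a b), ∃ y ∈ K, f y = x := by
  constructor
  · intro hxK
    rcases hx.1.eq_or_lt with rfl | hax
    · obtain ⟨f, hf, rfl, hfb⟩ := h.exists_vertex_left hab
      exact ⟨f, h.mem_islandVertices.2 ⟨hf, le_rfl, hfb⟩, 0, h.zero_mem, rfl⟩
    rcases hx.2.eq_or_lt with rfl | hxb
    · obtain ⟨f, hf, rfl, hfb⟩ := h.exists_vertex_right hab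
      exact ⟨f, h.mem_islandVertices.2 ⟨hf, hfb, le_rfl⟩, 1, h.one_mem, rfl⟩
    obtain ⟨f, hf, y, hy, rfl⟩ := h.exists_vertex k hxK
    obtain ⟨c, d, hcd, hc, hd⟩ := h.exists_island_of_vertex hf
    have hfy := h.vertex_mem_Icc hf (h.subset_Icc hy)
    rcases hab.eq_or_le hcd with ⟨rfl, rfl⟩ | hle | hle
    · exact ⟨f, h.mem_islandVertices.2 ⟨hf, hc, hd⟩, y, hy, rfl⟩
    · linarith [hfy.1]
    · linarith [hfy.2]
  · rintro ⟨f, hf, y, hy, rfl⟩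
    exact h.vertex_mem hf.1 hy

theorem exists_island_of_mem (h : IsNormalized Φ K M) (k : ℕ) (hx : x ∈ K) :
    ∃ a b, Φ.IsIsland M k a b ∧ x ∈ Icc a b := by
  obtain ⟨f, hf, y, hy, rfl⟩ := h.exists_vertex k hx
  obtain ⟨c, d, hcd, hc, hd⟩ := h.exists_island_of_vertex hf
  have hfy := h.vertex_mem_Icc hf (h.subset_Icc hy)
  exact ⟨c, d, hcd, hc.trans hfy.1, hfy.2.trans hd⟩

theorem exists_ancestor (h : IsNormalized Φ K M) {k k' : ℕ} (hk : k ≤ k')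
    (hab : Φ.IsIsland M k' a b) : ∃ c d, Φ.IsIsland M k c d ∧ c ≤ a ∧ b ≤ d := by
  have hsub := hab.subset.trans (h.openUnion_antitone hk)
  obtain ⟨x, hx⟩ := exists_between hab.lt
  obtain ⟨c, d, hcd, hxcd⟩ :=
    exists_isComponentInterval (h.isOpen_openUnion k) (h.isBounded_openUnion k) (hsub hx)
  exact ⟨c, d, hcd, hcd.subset_of_mem hxcd hx hsub⟩

theorem islands_zero (h : IsNormalized Φ K M) : Φ.IsIsland M 0 a b ↔ a = 0 ∧ b = 1 := by
  have hU : Φ.openUnion M 0 = Ioo 0 1 := by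
    simp [openUnion, vertexMaps, h.finiteType.indexSets.zero, wordMap]
  have h01 : Φ.IsIsland M 0 0 1 := ⟨one_pos, by rw [hU], by simp [hU], by simp [hU]⟩
  refine ⟨fun hab => ?_, by rintro ⟨rfl, rfl⟩; exact h01⟩
  have h1 := h.subset_Icc (h.left_mem hab)
  have h2 := h.subset_Icc (h.right_mem hab)
  rcases hab.eq_or_le h01 with he | hle | hle
  · exact he
  · linarith [hab.lt, h1.1]
  · linarith [hab.lt, h2.2]

/-- The endpoint is the image of 0 under a word, and `Φ.map 0` fixes 0, so appending letters 0 gives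
arbitrarily long words with the same left end. A long enough one extends a word of `M k'`, and
nestedness keeps the endpoint outside the later open union. -/
theorem exists_island_left (h : IsNormalized Φ K M) {k k' : ℕ} (hk : k ≤ k')
    (hab : Φ.IsIsland M k a b) : ∃ b', Φ.IsIsland M k' a b' := by
  have ha : a ∉ Φ.openUnion M k' := fun ha => hab.left_notMem (h.openUnion_antitone hk ha)
  obtain ⟨f, ⟨u, -, rfl⟩, rfl, -⟩ := h.exists_vertex_left hab
  set w := u ++ List.replicate (maxLength (M k') + 1) 0 with hw
  have hrep : ∀ N, Φ.wordMap (List.replicate N 0) 0 = 0 := by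
    intro N
    induction N with
    | zero => rfl
    | succ N ih =>
      rw [List.replicate_succ, wordMap, Function.comp_apply, ih, h.map_zero]
  have hw0 : Φ.wordMap w 0 = Φ.wordMap u 0 := by rw [hw, wordMap_append, hrep]
  obtain ⟨g, hg, v, hv⟩ := h.exists_vertex_of_word k' (w := w) (by simp [hw]; omega)
  have hlt := wordMap_strictMono (Φ := Φ) w (one_pos (α := ℝ))
  rw [← hw0] at ha ⊢
  have h0 : g 0 ≤ Φ.wordMap w 0 := by
    rw [hv]
    exact (h.vertex_mem_Icc hg (h.finiteType.invariant.wordMap_mem v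
      (left_mem_Icc.2 zero_le_one))).1
  have h1 : Φ.wordMap w 1 ≤ g 1 := by
    rw [hv]
    exact (h.vertex_mem_Icc hg (h.finiteType.invariant.wordMap_mem v
      (right_mem_Icc.2 zero_le_one))).2
  obtain ⟨c, d, hcd, hc, hd⟩ := h.exists_island_of_vertex hg
  have hce : c = Φ.wordMap w 0 := by
    by_contra hne
    exact ha (hcd.subset ⟨(hc.trans h0).lt_of_ne hne, hlt.trans_le (h1.trans hd)⟩)
  exact ⟨d, hce ▸ hcd⟩

theorem exists_island_right (h : IsNormalized Φ K M) {k k' : ℕ} (hk : k ≤ k')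
    (hab : Φ.IsIsland M k a b) : ∃ a', Φ.IsIsland M k' a' b := by
  have hb : b ∉ Φ.openUnion M k' := fun hb => hab.right_notMem (h.openUnion_antitone hk hb)
  obtain ⟨f, ⟨u, -, rfl⟩, rfl, -⟩ := h.exists_vertex_right hab
  set w := u ++ List.replicate (maxLength (M k') + 1) (Fin.last (n + 1)) with hw
  have hrep : ∀ N, Φ.wordMap (List.replicate N (Fin.last (n + 1))) 1 = 1 := by
    intro N
    induction N with
    | zero => rfl
    | succ N ih =>
      rw [List.replicate_succ, wordMap, Function.comp_apply, ih, h.map_one]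
  have hw1 : Φ.wordMap w 1 = Φ.wordMap u 1 := by rw [hw, wordMap_append, hrep]
  obtain ⟨g, hg, v, hv⟩ := h.exists_vertex_of_word k' (w := w) (by simp [hw]; omega)
  have hlt := wordMap_strictMono (Φ := Φ) w (one_pos (α := ℝ))
  rw [← hw1] at hb ⊢
  have h0 : g 0 ≤ Φ.wordMap w 0 := by
    rw [hv]
    exact (h.vertex_mem_Icc hg (h.finiteType.invariant.wordMap_mem v
      (left_mem_Icc.2 zero_le_one))).1
  have h1 : Φ.wordMap w 1 ≤ g 1 := by
    rw [hv]
    exact (h.vertex_mem_Icc hg (h.finiteType.invariant.wordMap_mem v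
      (right_mem_Icc.2 zero_le_one))).2
  obtain ⟨c, d, hcd, hc, hd⟩ := h.exists_island_of_vertex hg
  have hde : d = Φ.wordMap w 1 := by
    by_contra hne
    exact hb (hcd.subset ⟨(hc.trans h0).trans_lt hlt, (h1.trans hd).lt_of_ne (Ne.symm hne)⟩)
  exact ⟨c, hde ▸ hcd⟩

theorem finite_islands (h : IsNormalized Φ K M) (k : ℕ) :
    {p : ℝ × ℝ | Φ.IsIsland M k p.1 p.2}.Finite := by
  refine (((h.vertexMaps_finite k).image fun f => f 0).prod
    ((h.vertexMaps_finite k).image fun f => f 1)).subset fun p hp => ?_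
  obtain ⟨f, hf, hf0, -⟩ := h.exists_vertex_left hp
  obtain ⟨g, hg, hg1, -⟩ := h.exists_vertex_right hp
  exact ⟨⟨f, hf, hf0⟩, ⟨g, hg, hg1⟩⟩

/-- If `K` has no interior points, then the lengths of the islands tend to `0`. -/
theorem eventually_length_le (h : IsNormalized Φ K M) (hint : interior K = ∅) {η : ℝ}
    (hη : 0 < η) : ∀ᶠ k in atTop, ∀ a b, Φ.IsIsland M k a b → b - a ≤ η := by
  obtain ⟨r, hr0, hr1, hr⟩ := Φ.exists_wordMap_eq
  -- Vertex intervals have their endpoints in K and lengths tending to 0, so they eventually miss a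
  -- point at positive distance from K.
  have hpt : ∀ y ∉ K, ∀ᶠ k in atTop, y ∉ Φ.openUnion M k := by
    intro y hy
    obtain ⟨ε, hε, hball⟩ := Metric.isOpen_iff.1 h.isAttractor.isCompact.isClosed.isOpen_compl y hy
    have hlim : Tendsto (fun k => r ^ minLength (M k)) atTop (nhds 0) :=
      (tendsto_pow_atTop_nhds_zero_of_lt_one hr0.le hr1).comp
        h.finiteType.indexSets.minLength_tendsto
    filter_upwards [hlim.eventually (gt_mem_nhds hε)] with k hk hyU
    obtain ⟨f, hf, hf0, hf1⟩ := h.mem_openUnion.1 hyU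
    have hlen : f 1 - f 0 < ε := by
      obtain ⟨w, hw, rfl⟩ := hf
      obtain ⟨ρ, -, hρ, h2⟩ := hr w
      have h3 : minLength (M k) ≤ w.length := Nat.sInf_le ⟨w, hw, rfl⟩
      have h4 := pow_le_pow_of_le_one hr0.le hr1.le h3
      rw [h2 1]
      linarith
    refine hball (show f 0 ∈ Metric.ball y ε from ?_) (h.vertex_mem hf h.zero_mem)
    rw [Metric.mem_ball, Real.dist_eq, abs_lt]
    constructor <;> linarith
  -- Each cell of a grid of mesh η/2 has a point outside K, and only finitely many cells matter. An
  -- island longer than η would contain a whole cell together with its point.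
  have hgrid : ∀ j : ℕ, ∃ y ∈ Ioo (j * (η / 2)) ((j + 1) * (η / 2)), y ∉ K := by
    intro j
    by_contra hcon
    push Not at hcon
    have hsub : Ioo (j * (η / 2)) ((j + 1) * (η / 2)) ⊆ interior K :=
      interior_maximal hcon isOpen_Ioo
    rw [hint, subset_empty_iff, Ioo_eq_empty_iff] at hsub
    exact hsub (by nlinarith)
  choose y hy hyK using hgrid
  have hall : ∀ᶠ k in atTop, ∀ j ∈ Finset.range (⌈2 / η⌉₊ + 1), y j ∉ Φ.openUnion M k := by
    rw [Finset.eventually_all]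
    exact fun j _ => hpt _ (hyK j)
  filter_upwards [hall] with k hk a b hab
  by_contra hlt
  push Not at hlt
  have ha0 := (h.subset_Icc (h.left_mem hab)).1
  have ha1 := (h.subset_Icc (h.left_mem hab)).2
  have hle : a / (η / 2) ≤ 2 / η := by
    rw [div_le_div_iff₀ (by positivity) hη]
    nlinarith
  have h1 : a ≤ ⌈a / (η / 2)⌉₊ * (η / 2) := by
    rw [← div_le_iff₀ (by positivity)]
    exact Nat.le_ceil _
  have h2 : (⌈a / (η / 2)⌉₊ : ℝ) * (η / 2) < a + η / 2 := by
    have := Nat.ceil_lt_add_one (a := a / (η / 2)) (by positivity)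
    have h3 : a / (η / 2) * (η / 2) = a := by field_simp
    nlinarith
  refine hk ⌈a / (η / 2)⌉₊ (Finset.mem_range.2 (Nat.lt_succ_of_le (Nat.ceil_le_ceil hle)))
    (hab.subset ?_)
  obtain ⟨h3, h4⟩ := hy ⌈a / (η / 2)⌉₊
  exact ⟨by linarith, by linarith⟩

/-- Distinct islands of a generation at most `k` are separated by at least the length of the
shortest lake of generation `k`. -/
theorem add_lakeMin_le (h : IsNormalized Φ K M) {j k : ℕ} (hj : j ≤ k)
    (hab : Φ.IsIsland M j a b) (hab' : Φ.IsIsland M j a' b') (hle : b ≤ a') :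
    b + Φ.lakeMin M k ≤ a' := by
  obtain ⟨c, hc⟩ := h.exists_island_right hj hab
  obtain ⟨d, hd⟩ := h.exists_island_left hj hab'
  -- Both b and a' are still island endpoints in generation k, so the next island of that generation
  -- starts at some e ≤ a', and (b, e) is a lake.
  obtain ⟨⟨e, e'⟩, ⟨he, hbe⟩, hmin⟩ :=
    Set.exists_min_image {p : ℝ × ℝ | Φ.IsIsland M k p.1 p.2 ∧ b ≤ p.1} (fun p => p.1)
      ((h.finite_islands k).subset fun p hp => hp.1) ⟨(a', d), hd, hle⟩
  have hgap : Φ.IsGap M k b e := by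
    refine ⟨hbe, ⟨Icc c b, (h.Icc_mem_islands hc.lt.le).2 hc, csSup_Icc hc.lt.le⟩,
      ⟨Icc e e', (h.Icc_mem_islands he.lt.le).2 he, csInf_Icc he.lt.le⟩, fun I hI => ?_⟩
    obtain ⟨p, q, hpq, rfl⟩ := h.mem_islands.1 hI
    rw [Set.disjoint_left]
    intro z hz hz'
    rcases le_or_gt b p with hbp | hbp
    · have := hmin (p, q) ⟨hpq, hbp⟩
      simp only at this
      linarith [hz.1, hz'.2]
    · exact hc.right_notMem (hpq.subset ⟨hbp, hz'.1.trans_le hz.2⟩)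
  have hlake : Φ.lakeMin M k ≤ e - b :=
    csInf_le ⟨0, by rintro _ ⟨p, q, hpq, rfl⟩; exact sub_nonneg.2 hpq.1⟩ ⟨b, e, hgap, rfl⟩
  have := hmin (a', d) ⟨hd, hle⟩
  simp only at this
  linarith

theorem bddAbove_diam_islands (h : IsNormalized Φ K M) (k : ℕ) :
    BddAbove (Metric.diam '' Φ.islands M k) := by
  refine ⟨1, ?_⟩
  rintro _ ⟨I, hI, rfl⟩
  obtain ⟨a, b, hab, rfl⟩ := h.mem_islands.1 hI
  rw [Real.diam_Icc hab.lt.le]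
  linarith [(h.subset_Icc (h.left_mem hab)).1, (h.subset_Icc (h.right_mem hab)).2]

theorem length_le_islandMax (h : IsNormalized Φ K M) (hab : Φ.IsIsland M k a b) :
    b - a ≤ Φ.islandMax M k := by
  rw [← Real.diam_Icc hab.lt.le]
  exact le_csSup (h.bddAbove_diam_islands k) ⟨_, (h.Icc_mem_islands hab.lt.le).2 hab, rfl⟩

theorem tendsto_islandMax (h : IsNormalized Φ K M) (hint : interior K = ∅) {η : ℝ}
    (hη : 0 < η) : ∀ᶠ k in atTop, Φ.islandMax M k ≤ η := by
  filter_upwards [h.eventually_length_le hint hη] with k hk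
  refine Real.sSup_le ?_ hη.le
  rintro _ ⟨I, hI, rfl⟩
  obtain ⟨a, b, hab, rfl⟩ := h.mem_islands.1 hI
  rw [Real.diam_Icc hab.lt.le]
  exact hk a b hab

end IsNormalized

end LinearIFS

end

/-! ### Similarity of islands and the blow-up to early generations. -/

noncomputable section

namespace LinearIFS

theorem exists_affineEquiv_apply (τ : ℝ ≃ᵃ[ℝ] ℝ) : ∃ s t : ℝ, ∀ x, τ x = s * x + t := by
  refine ⟨τ.linear 1, τ 0, fun x => ?_⟩
  have h1 := τ.map_vadd 0 x
  have h2 : τ.linear x = τ.linear 1 * x := by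
    have := τ.linear.map_smul x 1
    rw [smul_eq_mul, mul_one, smul_eq_mul] at this
    rw [this, mul_comm]
  rw [vadd_eq_add, add_zero, vadd_eq_add, h2] at h1
  exact h1

theorem affine_image_Icc {s : ℝ} (hs : 0 < s) (t a b : ℝ) :
    (fun x => s * x + t) '' Icc a b = Icc (s * a + t) (s * b + t) := by
  have : (fun x => s * x + t) = (fun x => x + t) ∘ fun x => s * x := rfl
  rw [this, image_comp, image_mul_left_Icc' hs, image_add_const_Icc]

/-- The map `x ↦ s x + t` sends the `k`-th generation island `[a, b]` to a `k'`-th generation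
island, and it matches the portions of `K` and the later generation islands in them. In contrast to
`IslandEquiv`, the vertices are disregarded, so that this relation is inherited by the
offsprings. -/
structure IslandSimilar {m : ℕ} (Φ : LinearIFS m) (K : Set ℝ) (M : ℕ → Finset (List (Fin m)))
    (k : ℕ) (a b : ℝ) (k' : ℕ) (s t : ℝ) : Prop where
  pos : 0 < s
  isIsland : Φ.IsIsland M k' (s * a + t) (s * b + t)
  mem_iff : ∀ x ∈ Icc a b, x ∈ K ↔ s * x + t ∈ K
  isIsland_iff : ∀ l, 1 ≤ l → ∀ c d, a ≤ c → d ≤ b →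
    (Φ.IsIsland M (k + l) c d ↔ Φ.IsIsland M (k' + l) (s * c + t) (s * d + t))

section

variable {m : ℕ} {Φ : LinearIFS m} {K : Set ℝ} {M : ℕ → Finset (List (Fin m))}
  {k k' k'' : ℕ} {a b c d s t s' t' : ℝ}

theorem IslandSimilar.refl (h : Φ.IsIsland M k a b) : IslandSimilar Φ K M k a b k 1 0 :=
  ⟨one_pos, by simpa using h, fun x _ => by simp, fun l _ c d _ _ => by simp⟩

theorem IslandSimilar.trans (h : IslandSimilar Φ K M k a b k' s t)
    (h' : IslandSimilar Φ K M k' (s * a + t) (s * b + t) k'' s' t') :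
    IslandSimilar Φ K M k a b k'' (s' * s) (s' * t + t') := by
  have e : ∀ x, s' * s * x + (s' * t + t') = s' * (s * x + t) + t' := fun x => by ring
  have hs := h.pos
  refine ⟨mul_pos h'.pos hs, by rw [e, e]; exact h'.isIsland, fun x hx => ?_,
    fun l hl c d hc hd => ?_⟩
  · rw [e, h.mem_iff x hx]
    exact h'.mem_iff _ ⟨by gcongr; exact hx.1, by gcongr; exact hx.2⟩
  · rw [e, e, h.isIsland_iff l hl c d hc hd]
    exact h'.isIsland_iff l hl _ _ (by gcongr) (by gcongr)

theorem IslandSimilar.offspring (h : IslandSimilar Φ K M k a b k' s t) (hc : a ≤ c) (hd : d ≤ b)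
    (hcd : Φ.IsIsland M (k + 1) c d) : IslandSimilar Φ K M (k + 1) c d (k' + 1) s t := by
  refine ⟨h.pos, (h.isIsland_iff 1 le_rfl c d hc hd).1 hcd,
    fun x hx => h.mem_iff x ⟨hc.trans hx.1, hx.2.trans hd⟩, fun l hl p q hp hq => ?_⟩
  rw [add_assoc, add_assoc]
  exact h.isIsland_iff (1 + l) (by omega) p q (hc.trans hp) (hq.trans hd)

end

namespace IsNormalized

variable {n : ℕ} {Φ : LinearIFS (n + 2)} {K : Set ℝ} {M : ℕ → Finset (List (Fin (n + 2)))}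
  {k k₀ : ℕ} {a b x y : ℝ}

/-- The map realizing the equivalence of two islands is increasing and matches the portions of
`K`. -/
theorem exists_islandSimilar (h : IsNormalized Φ K M) {I I' : Φ.Island M}
    (hI : I.carrier = Icc a b) (hab : Φ.IsIsland M I.gen a b) (he : Φ.IslandEquiv M I I') :
    ∃ s t : ℝ, IslandSimilar Φ K M I.gen a b I'.gen s t ∧
      I'.carrier = Icc (s * a + t) (s * b + t) ∧
      Φ.islandVertices M I'.gen I'.carrier
        = (fun f => (fun x => s * x + t) ∘ f) '' Φ.islandVertices M I.gen I.carrier := by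
  obtain ⟨τ, h1, h2, h3⟩ := he
  obtain ⟨s, t, hst⟩ := exists_affineEquiv_apply τ
  have hτ : (τ : ℝ → ℝ) = fun x => s * x + t := funext hst
  rw [hτ] at h1 h2 h3
  -- Vertices are increasing and τ ∘ f is again a vertex, so τ cannot reverse orientation.
  have hs : 0 < s := by
    obtain ⟨f, hf, hfa, hfb⟩ := h.exists_vertex_left hab
    have hfI : f ∈ Φ.islandVertices M I.gen I.carrier := by
      rw [hI, h.mem_islandVertices]
      exact ⟨hf, hfa.ge, hfb⟩
    have hg : (fun x => s * x + t) ∘ f ∈ Φ.islandVertices M I'.gen I'.carrier := by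
      rw [h2]
      exact ⟨f, hfI, rfl⟩
    have h4 := h.vertex_lt hf
    have h5 := h.vertex_lt hg.1
    simp only [Function.comp_apply] at h5
    by_contra hle
    push Not at hle
    nlinarith
  rw [hI, affine_image_Icc hs] at h1
  have hab' : Φ.IsIsland M I'.gen (s * a + t) (s * b + t) := by
    have hmem := I'.mem
    rwa [← h1, h.Icc_mem_islands (by gcongr; exact hab.lt.le)] at hmem
  refine ⟨s, t, ⟨hs, hab', fun x hx => ?_, fun l hl c d hc hd => ?_⟩, h1.symm, h2⟩
  · rw [h.mem_iff_of_mem_island hab hx, h.mem_iff_of_mem_island hab'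
      ⟨by gcongr; exact hx.1, by gcongr; exact hx.2⟩, h1, h2, ← hI]
    constructor
    · rintro ⟨f, hf, y, hy, rfl⟩
      exact ⟨_, ⟨f, hf, rfl⟩, y, hy, rfl⟩
    · rintro ⟨_, ⟨f, hf, rfl⟩, y, hy, hxy⟩
      refine ⟨f, hf, y, hy, mul_left_cancel₀ hs.ne' ?_⟩
      simpa using hxy
  · rcases lt_or_ge d c with hdc | hcd
    · refine iff_of_false (fun hI => absurd hI.lt hdc.not_gt) fun hI => ?_
      exact absurd hI.lt (not_lt.2 (by gcongr))
    · have h4 := h3 l hl (Icc c d)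
      rw [affine_image_Icc hs, h.Icc_mem_islands hcd, h.Icc_mem_islands (by gcongr), hI, ← h1] at h4
      rwa [and_iff_left (Icc_subset_Icc hc hd),
        and_iff_left (Icc_subset_Icc (by gcongr) (by gcongr))] at h4

/-- Up to similarity, all islands occur in the generations up to `k₀`. -/
theorem exists_islandSimilar_le (h : IsNormalized Φ K M) (hk₀ : Φ.NoNewType M k₀) (k : ℕ) :
    ∀ a b, Φ.IsIsland M k a b → ∃ k' ≤ k₀, ∃ s t, IslandSimilar Φ K M k a b k' s t := by
  induction k with
  | zero => exact fun a b hab => ⟨0, Nat.zero_le _, 1, 0, .refl hab⟩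
  | succ k ih =>
    intro a b hab
    obtain ⟨c, d, hcd, hc, hd⟩ := h.exists_ancestor k.le_succ hab
    obtain ⟨k', hk', s, t, hst⟩ := ih c d hcd
    have hoff := hst.offspring hc hd hab
    rcases hk'.lt_or_eq with hlt | rfl
    · exact ⟨k' + 1, hlt, s, t, hoff⟩
    -- The image has generation k₀ + 1, so its type occurs in a generation at most k₀; composing
    -- with that equivalence lowers the generation.
    · have hisl := hoff.isIsland
      let I : Φ.Island M :=
        ⟨k' + 1, Icc (s * a + t) (s * b + t), (h.Icc_mem_islands hisl.lt.le).2 hisl⟩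
      obtain ⟨I', hI', htype⟩ := hk₀ I rfl
      have he : Φ.IslandEquiv M I I' := Quotient.exact htype.symm
      obtain ⟨s', t', hst', -⟩ := h.exists_islandSimilar (I := I) rfl hisl he
      exact ⟨I'.gen, hI', _, _, hoff.trans hst'⟩

/-- Any two points of `K` lie in an island that is similar to one of generation at most `k₀`, with
the images of the points in distinct offsprings. -/
theorem exists_islandSimilar_lakeMin_le (h : IsNormalized Φ K M) (hint : interior K = ∅)
    (hk₀ : Φ.NoNewType M k₀) (hlake : 0 < Φ.lakeMin M (k₀ + 1)) (hx : x ∈ K) (hy : y ∈ K)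
    (hxy : x < y) : ∃ k a b k' s t, Φ.IsIsland M k a b ∧ x ∈ Icc a b ∧ y ∈ Icc a b ∧
      IslandSimilar Φ K M k a b k' s t ∧ Φ.lakeMin M (k₀ + 1) ≤ s * (y - x) := by
  classical
  -- Island lengths tend to 0, so in some generation no island contains both points. The generation
  -- chosen below precedes the first such one.
  have hex : ∃ k, ¬ ∃ a b, Φ.IsIsland M k a b ∧ x ∈ Icc a b ∧ y ∈ Icc a b := by
    obtain ⟨k, hk⟩ := (h.eventually_length_le hint (half_pos (sub_pos.2 hxy))).exists
    refine ⟨k, ?_⟩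
    rintro ⟨a, b, hab, hxa, hyb⟩
    linarith [hk a b hab, hxa.1, hyb.2]
  have hfind := Nat.find_spec hex
  have hmin : ∀ j < Nat.find hex, ∃ a b, Φ.IsIsland M j a b ∧ x ∈ Icc a b ∧ y ∈ Icc a b :=
    fun j hj => not_not.1 (Nat.find_min hex hj)
  rcases hk : Nat.find hex with _ | k
  · rw [hk] at hfind
    exact absurd ⟨0, 1, h.islands_zero.2 ⟨rfl, rfl⟩, h.subset_Icc hx, h.subset_Icc hy⟩ hfind
  rw [hk] at hfind
  obtain ⟨a, b, hab, hxab, hyab⟩ := hmin k (by omega)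
  obtain ⟨k', hk', s, t, hst⟩ := h.exists_islandSimilar_le hk₀ k a b hab
  refine ⟨k, a, b, k', s, t, hab, hxab, hyab, hst, ?_⟩
  have hs := hst.pos
  -- Distinct islands of generation k' ≤ k₀ are a positive distance apart, so an island of
  -- generation k' + 1 containing the image of z descends from the image island.
  have hchild : ∀ z ∈ K, z ∈ Icc a b → ∃ c d, Φ.IsIsland M (k' + 1) c d ∧
      s * a + t ≤ c ∧ d ≤ s * b + t ∧ s * z + t ∈ Icc c d := by
    intro z hz hzab
    obtain ⟨c, d, hcd, hzc, hzd⟩ := h.exists_island_of_mem (k' + 1) ((hst.mem_iff z hzab).1 hz)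
    obtain ⟨c', d', hcd', hc, hd⟩ := h.exists_ancestor k'.le_succ hcd
    have h1 : s * a + t ≤ s * z + t := by gcongr; exact hzab.1
    have h2 : s * z + t ≤ s * b + t := by gcongr; exact hzab.2
    rcases hcd'.eq_or_le hst.isIsland with ⟨rfl, rfl⟩ | hle | hle
    · exact ⟨c, d, hcd, hc, hd, hzc, hzd⟩
    · have := h.add_lakeMin_le (k := k₀ + 1) (by omega) hcd' hst.isIsland hle
      linarith
    · have := h.add_lakeMin_le (k := k₀ + 1) (by omega) hst.isIsland hcd' hle
      linarith
  obtain ⟨c, d, hcd, hc, hd, hxc, hxd⟩ := hchild x hx hxab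
  obtain ⟨c', d', hcd', hc', hd', hyc, hyd⟩ := hchild y hy hyab
  have hlt : s * x < s * y := by gcongr
  rcases hcd.eq_or_le hcd' with ⟨rfl, rfl⟩ | hle | hle
  -- A common offspring would pull back to an island of generation k + 1 containing both x and y.
  · refine absurd ⟨(c - t) / s, (d - t) / s, ?_, ?_, ?_⟩ hfind
    · rw [hst.isIsland_iff 1 le_rfl, mul_div_cancel₀ _ hs.ne', mul_div_cancel₀ _ hs.ne',
        sub_add_cancel, sub_add_cancel]
      · exact hcd
      · rw [le_div_iff₀ hs]; linarith
      · rw [div_le_iff₀ hs]; linarith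
    · rw [mem_Icc, div_le_iff₀ hs, le_div_iff₀ hs]
      constructor <;> linarith
    · rw [mem_Icc, div_le_iff₀ hs, le_div_iff₀ hs]
      constructor <;> linarith
  · have := h.add_lakeMin_le (k := k₀ + 1) (by omega) hcd hcd' hle
    linarith
  · linarith

/-- If the lakes of generation `k₀ + 1` are nonempty, then so are the lakes of all generations. -/
theorem islands_ne (h : IsNormalized Φ K M) (hk₀ : Φ.NoNewType M k₀)
    (hlake : 0 < Φ.lakeMin M (k₀ + 1)) (k : ℕ) :
    ∀ a b c, Φ.IsIsland M k a b → ¬ Φ.IsIsland M k b c := by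
  induction k with
  | zero =>
    intro a b c hab hbc
    linarith [(h.islands_zero.1 hab).2, (h.islands_zero.1 hbc).1]
  | succ k ih =>
    intro a b c hab hbc
    obtain ⟨p, q, hpq, hp, hq⟩ := h.exists_ancestor k.le_succ hab
    obtain ⟨p', q', hpq', hp', hq'⟩ := h.exists_ancestor k.le_succ hbc
    have h1 := hab.lt
    have h2 := hbc.lt
    rcases hpq.eq_or_le hpq' with ⟨rfl, rfl⟩ | hle | hle
    · obtain ⟨k', hk', s, t, hst⟩ := h.exists_islandSimilar_le hk₀ k p q hpq
      have := h.add_lakeMin_le (k := k₀ + 1) (by omega) (hst.offspring hp hq hab).isIsland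
        (hst.offspring hp' hq' hbc).isIsland le_rfl
      linarith
    · have e : q = p' := by linarith
      subst e
      exact ih _ _ _ hpq hpq'
    · linarith

/-- Vertex counts and relative vertex lengths depend only on the type. As there are finitely many
types, their representatives yield uniform bounds. -/
theorem island_eq_representative (h : IsNormalized Φ K M) (hab : Φ.IsIsland M k a b) :
    ∃ (T : Φ.OverlapType M) (c d s t : ℝ),
      (Φ.representative M T).carrier = Icc c d ∧
      Φ.IsIsland M (Φ.representative M T).gen c d ∧ 0 < s ∧ a = s * c + t ∧ b = s * d + t ∧
      Φ.islandVertices M k (Icc a b) = (fun f => (fun x => s * x + t) ∘ f) ''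
        Φ.islandVertices M (Φ.representative M T).gen (Φ.representative M T).carrier := by
  set I : Φ.Island M := ⟨k, Icc a b, (h.Icc_mem_islands hab.lt.le).2 hab⟩ with hI
  obtain ⟨c, d, hcd, he⟩ := h.mem_islands.1 (Φ.representative M (Φ.typeOf M I)).mem
  obtain ⟨s, t, h1, h2, h3⟩ := h.exists_islandSimilar he hcd
    (Quotient.exact (Quotient.out_eq (Φ.typeOf M I)) : Φ.IslandEquiv M _ I)
  obtain ⟨e1, e2⟩ := (Icc_eq_Icc_iff hab.lt.le).1 (show Icc a b = _ from h2)
  exact ⟨_, c, d, s, t, he, hcd, h1.pos, e1, e2, h3⟩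

theorem exists_ncard_islandVertices_le (h : IsNormalized Φ K M) : ∃ N : ℕ, ∀ k a b,
    Φ.IsIsland M k a b → (Φ.islandVertices M k (Icc a b)).ncard ≤ N := by
  have := h.finiteType.finite
  obtain ⟨N, hN⟩ := (Set.finite_range fun T : Φ.OverlapType M => (Φ.islandVertices M
    (Φ.representative M T).gen (Φ.representative M T).carrier).ncard).bddAbove
  refine ⟨N, fun k a b hab => ?_⟩
  obtain ⟨T, c, d, s, t, -, -, -, -, -, hV⟩ := h.island_eq_representative hab
  rw [hV]
  exact (Set.ncard_image_le ((h.vertexMaps_finite _).subset fun f hf => hf.1)).trans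
    (hN ⟨T, rfl⟩)

theorem exists_vertex_mul_length_le (h : IsNormalized Φ K M) : ∃ c : ℝ, 0 < c ∧ ∀ k a b,
    Φ.IsIsland M k a b → ∃ f ∈ Φ.islandVertices M k (Icc a b), c * (b - a) ≤ f 1 - f 0 := by
  have := h.finiteType.finite
  have hT : ∀ T : Φ.OverlapType M, ∃ c : ℝ, 0 < c ∧ ∃ f ∈ Φ.islandVertices M
      (Φ.representative M T).gen (Φ.representative M T).carrier,
      c * Metric.diam (Φ.representative M T).carrier ≤ f 1 - f 0 := by
    intro T
    obtain ⟨p, q, hpq, he⟩ := h.mem_islands.1 (Φ.representative M T).mem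
    obtain ⟨f, hf, hf0, hf1⟩ := h.exists_vertex_left hpq
    have hlt := sub_pos.2 hpq.lt
    refine ⟨(f 1 - f 0) / (q - p), div_pos (sub_pos.2 (h.vertex_lt hf)) hlt, f, ?_, ?_⟩
    · rw [he]
      exact h.mem_islandVertices.2 ⟨hf, hf0.ge, hf1⟩
    · rw [he, Real.diam_Icc hpq.lt.le, div_mul_cancel₀ _ hlt.ne']
  choose c hc f hf hfc using hT
  have : Nonempty (Φ.OverlapType M) :=
    ⟨Φ.typeOf M ⟨0, Icc 0 1, (h.Icc_mem_islands zero_le_one).2 (h.islands_zero.2 ⟨rfl, rfl⟩)⟩⟩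
  obtain ⟨T₀, hT₀⟩ := Finite.exists_min c
  refine ⟨c T₀, hc T₀, fun k a b hab => ?_⟩
  obtain ⟨T, p, q, s, t, he, hpq, hs, rfl, rfl, hV⟩ := h.island_eq_representative hab
  rw [hV]
  refine ⟨_, ⟨f T, hf T, rfl⟩, ?_⟩
  have h1 := hfc T
  rw [he, Real.diam_Icc hpq.lt.le] at h1
  have h2 : c T₀ * (q - p) ≤ c T * (q - p) :=
    mul_le_mul_of_nonneg_right (hT₀ T) (sub_nonneg.2 hpq.lt.le)
  simp only [Function.comp_apply]
  nlinarith

/-- Each island contains a vertex interval of at least a fixed proportion of its length, and islands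
of one generation are disjoint by `islands_ne`. -/
theorem exists_similar_cover (h : IsNormalized Φ K M) (hk₀ : Φ.NoNewType M k₀) (hlake : 0 < Φ.lakeMin M (k₀ + 1)) :
    ∃ c : ℝ, 0 < c ∧ ∀ k, ∃ (S : Finset (ℝ × ℝ)) (ρ σ : ℝ × ℝ → ℝ),
      (∀ I, I ∈ S ↔ Φ.IsIsland M k I.1 I.2) ∧ (K ⊆ ⋃ I ∈ S, Icc I.1 I.2) ∧
      (∀ I ∈ S, ∀ J ∈ S, I ≠ J → Disjoint (Icc I.1 I.2) (Icc J.1 J.2)) ∧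
      ∀ I ∈ S, 0 < ρ I ∧ ρ I ≤ 1 ∧ c * (I.2 - I.1) ≤ ρ I ∧
      I.1 ≤ σ I ∧ ρ I + σ I ≤ I.2 ∧ ∀ x ∈ K, ρ I * x + σ I ∈ K := by
  obtain ⟨c, hc, hcf⟩ := h.exists_vertex_mul_length_le
  refine ⟨c, hc, fun k => ?_⟩
  have hf : ∀ I : ℝ × ℝ, ∃ f : ℝ → ℝ, Φ.IsIsland M k I.1 I.2 →
      f ∈ Φ.islandVertices M k (Icc I.1 I.2) ∧ c * (I.2 - I.1) ≤ f 1 - f 0 := by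
    intro I
    by_cases hI : Φ.IsIsland M k I.1 I.2
    · obtain ⟨f, hf, hf'⟩ := hcf k _ _ hI
      exact ⟨f, fun _ => ⟨hf, hf'⟩⟩
    · exact ⟨id, fun hI' => absurd hI' hI⟩
  choose f hf using hf
  have hmem : ∀ I, I ∈ (h.finite_islands k).toFinset ↔ Φ.IsIsland M k I.1 I.2 := fun I => by simp
  refine ⟨(h.finite_islands k).toFinset, fun I => f I 1 - f I 0, fun I => f I 0, hmem, ?_, ?_, ?_⟩
  · intro x hx
    obtain ⟨a, b, hab, hxab⟩ := h.exists_island_of_mem k hx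
    exact mem_iUnion₂.2 ⟨(a, b), (hmem _).2 hab, hxab⟩
  · rintro ⟨a, b⟩ hI ⟨a', b'⟩ hJ hIJ
    rw [hmem] at hI hJ
    simp only at hI hJ ⊢
    rw [Set.disjoint_left]
    rintro z ⟨hz1, hz2⟩ ⟨hz3, hz4⟩
    rcases hI.eq_or_le hJ with ⟨rfl, rfl⟩ | hle | hle
    · exact hIJ rfl
    · obtain rfl : b = a' := by linarith
      exact h.islands_ne hk₀ hlake k _ _ _ hI hJ
    · obtain rfl : b' = a := by linarith
      exact h.islands_ne hk₀ hlake k _ _ _ hJ hI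
  · intro I hI
    obtain ⟨hfV, hfc⟩ := hf I ((hmem I).1 hI)
    obtain ⟨hfV', h0, h1⟩ := h.mem_islandVertices.1 hfV
    refine ⟨sub_pos.2 (h.vertex_lt hfV'), ?_, hfc, h0, by linarith, fun x hx => ?_⟩
    · linarith [h.vertex_nonneg hfV', h.vertex_le_one hfV']
    · rw [← h.vertex_apply hfV']
      exact h.vertex_mem hfV' hx

end IsNormalized

end LinearIFS

end

/-! ### Densities of intervals and existence of a maximizer. -/

noncomputable section

section Density

variable {K J : Set ℝ} {α : ℝ≥0} {p q x y : ℝ}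

/-- For α > 0 the Hausdorff measure has no atoms, so λ has a continuous distribution function. This
makes density continuous in the endpoints. -/
theorem exists_continuous_normalizedMeasure (hα0 : 0 < α) (ht : Measure.hausdorffMeasure α K ≠ ⊤) :
    ∃ G : ℝ → ℝ, Continuous G ∧ ∀ p q, p ≤ q →
      normalizedMeasure K α (Icc p q) = G q - G p := by
  have hatom := Measure.nullSingletonClass_hausdorff ℝ (d := (α : ℝ)) hα0
  set P : Measure ℝ := (Measure.hausdorffMeasure (α : ℝ)).restrict K with hP
  have hfin : IsFiniteMeasure P := ⟨by rw [hP, Measure.restrict_apply_univ]; exact ht.lt_top⟩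
  have hint : ∀ a b, IntervalIntegrable (fun _ : ℝ => (1 : ℝ)) P a b := fun a b =>
    intervalIntegrable_const
  refine ⟨fun x => (∫ t in (0 : ℝ)..x, (1 : ℝ) ∂P) / (Measure.hausdorffMeasure α K).toReal,
    (intervalIntegral.continuous_primitive hint 0).div_const _, fun p q hpq => ?_⟩
  rw [← sub_div, intervalIntegral.integral_interval_sub_left (hint _ _) (hint _ _),
    intervalIntegral.integral_of_le hpq, ← integral_Icc_eq_integral_Ioc, setIntegral_const,
    smul_eq_mul, mul_one, normalizedMeasure, measureReal_def, hP,
    Measure.restrict_apply measurableSet_Icc, inter_comm]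

theorem normalizedMeasure_nonneg : 0 ≤ normalizedMeasure K α J := by
  unfold normalizedMeasure
  positivity

theorem normalizedMeasure_mono (ht : Measure.hausdorffMeasure α K ≠ ⊤) {A B : Set ℝ}
    (h : K ∩ A ⊆ B) : normalizedMeasure K α A ≤ normalizedMeasure K α B := by
  refine div_le_div_of_nonneg_right (ENNReal.toReal_mono
    (ne_top_of_le_ne_top ht (measure_mono inter_subset_left))
    (measure_mono (subset_inter inter_subset_left h))) (by positivity)

theorem normalizedMeasure_le_one (ht : Measure.hausdorffMeasure α K ≠ ⊤) :
    normalizedMeasure K α J ≤ 1 := by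
  exact div_le_one_of_le₀ (ENNReal.toReal_mono ht (measure_mono inter_subset_left)) (by positivity)

theorem normalizedMeasure_of_subset (h0 : Measure.hausdorffMeasure α K ≠ 0)
    (ht : Measure.hausdorffMeasure α K ≠ ⊤) (h : K ⊆ J) : normalizedMeasure K α J = 1 := by
  rw [normalizedMeasure, inter_eq_left.2 h, div_self (ENNReal.toReal_pos h0 ht).ne']

theorem normalizedMeasure_affine {s t : ℝ} (hs : 0 < s) {A B : Set ℝ}
    (h : K ∩ B = (fun x => s * x + t) '' (K ∩ A)) :
    normalizedMeasure K α B = s ^ (α : ℝ) * normalizedMeasure K α A := by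
  rw [normalizedMeasure, normalizedMeasure, h, hausdorffMeasure_affine_image α.coe_nonneg hs.ne',
    ENNReal.toReal_mul, abs_of_pos hs, ENNReal.ofReal_rpow_of_pos hs,
    ENNReal.toReal_ofReal (by positivity), mul_div_assoc]

theorem rpow_mul_normalizedMeasure_le (ht : Measure.hausdorffMeasure α K ≠ ⊤) {s t : ℝ}
    (hs : 0 < s) (hmap : ∀ x ∈ K, s * x + t ∈ K) {A B : Set ℝ} (hAB : ∀ x ∈ A, s * x + t ∈ B) :
    s ^ (α : ℝ) * normalizedMeasure K α A ≤ normalizedMeasure K α B := by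
  have hsub : (fun x => s * x + t) '' (K ∩ A) ⊆ K := by
    rintro _ ⟨x, hx, rfl⟩
    exact hmap x hx.1
  rw [← normalizedMeasure_affine (B := (fun x => s * x + t) '' (K ∩ A)) hs
    (inter_eq_right.2 hsub)]
  refine normalizedMeasure_mono ht (inter_subset_right.trans ?_)
  rintro _ ⟨x, hx, rfl⟩
  exact hAB x hx.2

theorem density_Icc (hpq : p ≤ q) :
    density K α (Icc p q) = normalizedMeasure K α (Icc p q) / (q - p) ^ (α : ℝ) := by
  rw [density, Real.diam_Icc hpq]

theorem density_nonneg : 0 ≤ density K α J :=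
  div_nonneg normalizedMeasure_nonneg (Real.rpow_nonneg Metric.diam_nonneg _)

theorem normalizedMeasure_Icc_eq (hpq : p < q) :
    normalizedMeasure K α (Icc p q) = density K α (Icc p q) * (q - p) ^ (α : ℝ) := by
  rw [density_Icc hpq.le, div_mul_cancel₀ _ (Real.rpow_pos_of_pos (sub_pos.2 hpq) _).ne']

theorem exists_Icc_of_nontrivial_inter (hK : IsCompact K) (h : (K ∩ J).Nontrivial) :
    ∃ x ∈ K, ∃ y ∈ K, x < y ∧ K ∩ J ⊆ Icc x y ∧ y - x = Metric.diam (K ∩ J) := by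
  have hb : Bornology.IsBounded (K ∩ J) := hK.isBounded.subset inter_subset_left
  have hcl : closure (K ∩ J) ⊆ K := closure_minimal inter_subset_left hK.isClosed
  refine ⟨_, hcl (csInf_mem_closure h.nonempty hb.bddBelow), _,
    hcl (csSup_mem_closure h.nonempty hb.bddAbove), ?_,
    fun z hz => ⟨csInf_le hb.bddBelow hz, le_csSup hb.bddAbove hz⟩, (Real.diam_eq hb).symm⟩
  obtain ⟨a, ha, b, hb', hab⟩ := h.exists_lt
  exact (csInf_le hb.bddBelow ha).trans_lt (hab.trans_le (le_csSup hb.bddAbove hb'))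

theorem density_eq_zero_of_subsingleton (hα0 : 0 < α) (h : (K ∩ J).Subsingleton) :
    density K α J = 0 := by
  have hatom := Measure.nullSingletonClass_hausdorff ℝ (d := (α : ℝ)) hα0
  rw [density, normalizedMeasure, h.measure_zero]
  simp

/-- Shrinking J to the closed convex hull of K ∩ J loses no mass and does not increase the length.
-/
theorem density_le_density_Icc (hK : IsCompact K) (ht : Measure.hausdorffMeasure α K ≠ ⊤)
    (hJ : Bornology.IsBounded J) (h : (K ∩ J).Nontrivial) :
    ∃ x ∈ K, ∃ y ∈ K, x < y ∧ density K α J ≤ density K α (Icc x y) := by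
  obtain ⟨x, hx, y, hy, hxy, hsub, hd⟩ := exists_Icc_of_nontrivial_inter hK h
  refine ⟨x, hx, y, hy, hxy, ?_⟩
  have hpos : 0 < (y - x) ^ (α : ℝ) := Real.rpow_pos_of_pos (sub_pos.2 hxy) _
  rw [density_Icc hxy.le, density]
  refine div_le_div₀ normalizedMeasure_nonneg (normalizedMeasure_mono ht hsub) hpos ?_
  refine Real.rpow_le_rpow (sub_pos.2 hxy).le ?_ α.coe_nonneg
  rw [hd]
  exact Metric.diam_mono inter_subset_right hJ

/-- Mass distribution principle: for small A the hull of K ∩ A has endpoints in K, so K ∩ A has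
measure at most dH diam(A)^α. Hence the measure restricted to K, divided by dH, is dominated by the
Hausdorff measure; evaluate at K. -/
theorem one_le_mul_of_density_le (hK : IsCompact K) (hα0 : 0 < α)
    (h0 : Measure.hausdorffMeasure α K ≠ 0) (ht : Measure.hausdorffMeasure α K ≠ ⊤) {d : ℝ}
    (hd0 : 0 < d) (hd : ∀ x ∈ K, ∀ y ∈ K, x < y → density K α (Icc x y) ≤ d) :
    1 ≤ d * (Measure.hausdorffMeasure α K).toReal := by
  have hatom := Measure.nullSingletonClass_hausdorff ℝ (d := (α : ℝ)) hα0
  set H := (Measure.hausdorffMeasure α K).toReal with hH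
  have hHpos : 0 < H := ENNReal.toReal_pos h0 ht
  have hs : 0 < d * H := mul_pos hd0 hHpos
  have hc0 : ENNReal.ofReal (d * H) ≠ 0 := (ENNReal.ofReal_pos.2 hs).ne'
  have hle : (ENNReal.ofReal (d * H))⁻¹ • (Measure.hausdorffMeasure (α : ℝ)).restrict K
      ≤ Measure.hausdorffMeasure (α : ℝ) := by
    refine Measure.le_hausdorffMeasure _ _ 1 one_pos fun A hA => ?_
    rw [Measure.smul_apply, smul_eq_mul, Measure.restrict_apply' hK.measurableSet,
      ENNReal.inv_mul_le_iff hc0 ENNReal.ofReal_ne_top, inter_comm]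
    rcases Set.subsingleton_or_nontrivial (K ∩ A) with hsub | hnt
    · rw [hsub.measure_zero]
      exact zero_le
    obtain ⟨x, hx, y, hy, hxy, hsub, hdiam⟩ := exists_Icc_of_nontrivial_inter hK hnt
    have h1 := hd x hx y hy hxy
    have hpos : 0 < (y - x) ^ (α : ℝ) := Real.rpow_pos_of_pos (sub_pos.2 hxy) _
    rw [density_Icc hxy.le, div_le_iff₀ hpos, normalizedMeasure, ← hH, div_le_iff₀ hHpos] at h1
    have hne : Measure.hausdorffMeasure (α : ℝ) (K ∩ Icc x y) ≠ ⊤ :=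
      ne_top_of_le_ne_top ht (measure_mono inter_subset_left)
    calc _ ≤ Measure.hausdorffMeasure (α : ℝ) (K ∩ Icc x y) :=
          measure_mono (subset_inter inter_subset_left hsub)
      _ = ENNReal.ofReal (Measure.hausdorffMeasure (α : ℝ) (K ∩ Icc x y)).toReal :=
          (ENNReal.ofReal_toReal hne).symm
      _ ≤ ENNReal.ofReal (d * H * (y - x) ^ (α : ℝ)) :=
          ENNReal.ofReal_le_ofReal (h1.trans_eq (by ring))
      _ = ENNReal.ofReal (d * H) * ENNReal.ofReal (y - x) ^ (α : ℝ) := by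
          rw [ENNReal.ofReal_mul hs.le, ENNReal.ofReal_rpow_of_pos (sub_pos.2 hxy)]
      _ ≤ _ := by
          gcongr
          rw [hdiam]
          exact ENNReal.ofReal_toReal_le.trans (Metric.ediam_mono inter_subset_right)
  have h1 := hle K
  rw [Measure.smul_apply, smul_eq_mul, Measure.restrict_apply_self,
    ENNReal.inv_mul_le_iff hc0 ENNReal.ofReal_ne_top] at h1
  have h2 := ENNReal.toReal_mono (ENNReal.mul_ne_top ENNReal.ofReal_ne_top ht) h1
  rw [ENNReal.toReal_mul, ENNReal.toReal_ofReal hs.le, ← hH] at h2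
  nlinarith

/-- An interval of maximal density cannot be extended cheaply: if an extension of it of length `x`
has mass at least `D x ^ α`, then `x` is not too small. -/
theorem rpow_lt_of_extension {α γ L D x d l : ℝ} (hα0 : 0 ≤ α) (hα1 : α < 1) (hγ : 0 < γ)
    (hγL : γ ≤ L) (hD : 0 ≤ D) (hx : 0 < x) (hl : l = d * L ^ α) (hl0 : 0 ≤ l) (hl1 : l ≤ 1)
    (h : D * x ^ α + l ≤ d * (L + x) ^ α) : (γ * D) ^ (1 / (1 - α)) < x := by
  have hL : 0 < L := hγ.trans_le hγL
  have hLα : 0 < L ^ α := Real.rpow_pos_of_pos hL _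
  have hd : 0 ≤ d := by
    by_contra hneg
    push Not at hneg
    nlinarith
  -- Bernoulli's inequality. Subtracting l = d L^α leaves D x^α ≤ l α x/L < x/γ, because l ≤ 1, α <
  -- 1 and L ≥ γ.
  have hbern : (L + x) ^ α ≤ L ^ α * (1 + α * (x / L)) := by
    have e : L + x = L * (1 + x / L) := by field_simp
    rw [e, Real.mul_rpow hL.le (by positivity)]
    gcongr
    exact rpow_one_add_le_one_add_mul_self (by linarith [div_pos hx hL]) hα0 hα1.le
  have h1 : D * x ^ α ≤ l * (α * (x / L)) := by
    have := mul_le_mul_of_nonneg_left hbern hd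
    rw [hl] at h ⊢
    nlinarith
  have hxL : x / L ≤ x / γ := by gcongr
  have h2 : D * x ^ α < x / γ := by
    have h3 : 0 < x / L := div_pos hx hL
    have h4 : l * (α * (x / L)) ≤ 1 * (α * (x / L)) := by gcongr
    nlinarith
  have hxα : 0 < x ^ α := Real.rpow_pos_of_pos hx _
  have h5 : γ * D < x ^ (1 - α) := by
    rw [Real.rpow_sub hx, Real.rpow_one, lt_div_iff₀ hxα]
    rw [lt_div_iff₀ hγ] at h2
    linarith
  have h6 : 0 < 1 - α := by linarith
  calc (γ * D) ^ (1 / (1 - α)) < (x ^ (1 - α)) ^ (1 / (1 - α)) :=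
        Real.rpow_lt_rpow (by positivity) h5 (by positivity)
    _ = x := by rw [← Real.rpow_mul hx.le, mul_one_div_cancel h6.ne', Real.rpow_one]

end Density

namespace LinearIFS

variable {n : ℕ} {Φ : LinearIFS (n + 2)} {K : Set ℝ} {M : ℕ → Finset (List (Fin (n + 2)))}
  {α : ℝ≥0} {k k₀ : ℕ} {a b x y : ℝ}

theorem IslandSimilar.density_eq {m : ℕ} {Φ : LinearIFS m} {M : ℕ → Finset (List (Fin m))}
    {k' : ℕ} {s t : ℝ} (h : IslandSimilar Φ K M k a b k' s t) (hx : x ∈ Icc a b)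
    (hy : y ∈ Icc a b) (hxy : x < y) :
    density K α (Icc (s * x + t) (s * y + t)) = density K α (Icc x y) := by
  have hs := h.pos
  have himg : K ∩ Icc (s * x + t) (s * y + t) = (fun z => s * z + t) '' (K ∩ Icc x y) := by
    rw [← affine_image_Icc hs]
    ext w
    constructor
    · rintro ⟨hw, z, hz, rfl⟩
      exact ⟨z, ⟨(h.mem_iff z ⟨hx.1.trans hz.1, hz.2.trans hy.2⟩).2 hw, hz⟩, rfl⟩
    · rintro ⟨z, ⟨hzK, hz⟩, rfl⟩
      exact ⟨(h.mem_iff z ⟨hx.1.trans hz.1, hz.2.trans hy.2⟩).1 hzK, z, hz, rfl⟩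
  have hlt : s * x + t < s * y + t := by gcongr
  have e : s * y + t - (s * x + t) = s * (y - x) := by ring
  rw [density_Icc hlt.le, density_Icc hxy.le, normalizedMeasure_affine hs himg, e,
    Real.mul_rpow hs.le (sub_pos.2 hxy).le, mul_div_mul_left _ _ (Real.rpow_pos_of_pos hs _).ne']

namespace IsNormalized

/-- Without lakes, `lakeMin` would be the infimum of the empty set, which is 0 by convention. So
there is a lake, with distinct islands on its two sides. -/
theorem two_islands (h : IsNormalized Φ K M) (hlake : Φ.lakeMin M k ≠ 0) :
    ∃ p q : ℝ × ℝ, Φ.IsIsland M k p.1 p.2 ∧ Φ.IsIsland M k q.1 q.2 ∧ p ≠ q := by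
  have hne : {c | ∃ a b, Φ.IsGap M k a b ∧ c = b - a}.Nonempty := by
    by_contra hempty
    rw [not_nonempty_iff_eq_empty] at hempty
    exact hlake (by rw [lakeMin, hempty, Real.sInf_empty])
  obtain ⟨_, a, b, ⟨hab, ⟨I, hI, rfl⟩, ⟨I', hI', rfl⟩, -⟩, -⟩ := hne
  obtain ⟨p, q, hpq, rfl⟩ := h.mem_islands.1 hI
  obtain ⟨p', q', hpq', rfl⟩ := h.mem_islands.1 hI'
  rw [csSup_Icc hpq.lt.le, csInf_Icc hpq'.lt.le] at hab
  refine ⟨(p, q), (p', q'), hpq, hpq', fun he => ?_⟩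
  obtain ⟨rfl, rfl⟩ := Prod.mk.inj he
  exact absurd hpq.lt (not_lt.2 hab)

/-- For α = 0 the bound Σ ρ^α ≤ 1 would allow only one island in generation k₀ + 1. -/
theorem dimension_pos (h : IsNormalized Φ K M) (hk₀ : Φ.NoNewType M k₀)
    (hlake : 0 < Φ.lakeMin M (k₀ + 1)) (hα : dimH K = α) : 0 < α := by
  obtain ⟨c, hc, hcov⟩ := h.exists_similar_cover hk₀ hlake
  obtain ⟨S, ρ, σ, hS, hKS, hdisj, hprop⟩ := hcov (k₀ + 1)
  have hle := HasSimilarCover.sum_rpow_le_one (δ := 1) (c := c) h.isAttractor.isCompact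
    h.isAttractor.nonempty h.subset_Icc hα hdisj fun I hI => by
      have hI' := (hS I).1 hI
      exact ⟨hI'.lt.le, by
        linarith [(h.subset_Icc (h.left_mem hI')).1, (h.subset_Icc (h.right_mem hI')).2],
        hprop I hI⟩
  by_contra hα0
  obtain rfl : α = 0 := by simpa using hα0
  obtain ⟨p, q, hp, hq, hpq⟩ := h.two_islands hlake.ne'
  have hcard : 1 < S.card := Finset.one_lt_card.2 ⟨p, (hS p).2 hp, q, (hS q).2 hq, hpq⟩
  simp only [NNReal.coe_zero, Real.rpow_zero, Finset.sum_const, nsmul_eq_mul, mul_one] at hle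
  exact absurd hle (not_le.2 (by exact_mod_cast hcard))

theorem hasSimilarCover (h : IsNormalized Φ K M) (hint : interior K = ∅)
    (hk₀ : Φ.NoNewType M k₀) (hlake : 0 < Φ.lakeMin M (k₀ + 1)) :
    ∃ c, 0 < c ∧ ∀ δ, 0 < δ → HasSimilarCover K c δ := by
  obtain ⟨c, hc, hcov⟩ := h.exists_similar_cover hk₀ hlake
  refine ⟨c, hc, fun δ hδ => ?_⟩
  obtain ⟨k, hk⟩ := (h.eventually_length_le hint hδ).exists
  obtain ⟨S, ρ, σ, hS, hKS, hdisj, hprop⟩ := hcov k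
  exact ⟨S, ρ, σ, hKS, hdisj, fun I hI =>
    ⟨((hS I).1 hI).lt.le, hk _ _ ((hS I).1 hI), hprop I hI⟩⟩

theorem hausdorffMeasure_ne_zero (h : IsNormalized Φ K M) (hint : interior K = ∅)
    (hk₀ : Φ.NoNewType M k₀) (hlake : 0 < Φ.lakeMin M (k₀ + 1)) (hα : dimH K = α) :
    Measure.hausdorffMeasure α K ≠ 0 := by
  classical
  obtain ⟨N, hN⟩ := h.exists_ncard_islandVertices_le
  refine hausdorffMeasure_ne_zero_of_portions h.isAttractor.isCompact
    (h.dimension_pos hk₀ hlake hα) hα (N := N) hlake fun x hx y hy hxy => ?_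
  obtain ⟨k, a, b, k', s, t, hab, hxab, hyab, hst, hle⟩ :=
    h.exists_islandSimilar_lakeMin_le hint hk₀ hlake hx hy hxy
  have hfin : (Φ.islandVertices M k (Icc a b)).Finite :=
    (h.vertexMaps_finite k).subset fun f hf => hf.1
  -- The blown-up island lies in [0,1], so s(b - a) ≤ 1, while γ ≤ s(y - x).
  have hlen : b - a ≤ (y - x) / Φ.lakeMin M (k₀ + 1) := by
    have h1 := (h.subset_Icc (h.left_mem hst.isIsland)).1
    have h2 := (h.subset_Icc (h.right_mem hst.isIsland)).2
    rw [le_div_iff₀ hlake]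
    have h3 : (b - a) * Φ.lakeMin M (k₀ + 1) ≤ (b - a) * (s * (y - x)) :=
      mul_le_mul_of_nonneg_left hle (sub_nonneg.2 hab.lt.le)
    have h4 : s * (b - a) * (y - x) ≤ 1 * (y - x) :=
      mul_le_mul_of_nonneg_right (by linarith) (sub_nonneg.2 hxy.le)
    linarith
  refine ⟨hfin.toFinset.image fun f => (f 1 - f 0, f 0), ?_, ?_, ?_⟩
  · refine Finset.card_image_le.trans ?_
    rw [← Set.ncard_eq_toFinset_card _ hfin]
    exact hN k a b hab
  · intro p hp
    obtain ⟨f, hf, rfl⟩ := Finset.mem_image.1 hp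
    obtain ⟨hfV, h0, h1⟩ := h.mem_islandVertices.1 (hfin.mem_toFinset.1 hf)
    exact ⟨sub_pos.2 (h.vertex_lt hfV), by linarith⟩
  · rintro z ⟨hzK, hz⟩
    obtain ⟨f, hf, w, hw, hfw⟩ := (h.mem_iff_of_mem_island hab
      ⟨hxab.1.trans hz.1, hz.2.trans hyab.2⟩).1 hzK
    refine mem_iUnion₂.2 ⟨(f 1 - f 0, f 0),
      Finset.mem_image.2 ⟨f, hfin.mem_toFinset.2 hf, rfl⟩, w, hw, ?_⟩
    rw [← hfw]
    exact (h.vertex_apply hf.1 w).symm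

theorem bddBelow_densities (A : Set ℝ) (J : ℝ → Set ℝ) :
    BddBelow {c | ∃ x : ℝ, 0 < x ∧ x ≤ 1 ∧ c = density A α (J x)} :=
  ⟨0, by rintro _ ⟨x, -, -, rfl⟩; exact density_nonneg⟩

theorem lowerDensityLeft_le (hx : 0 < x) (hx1 : x ≤ 1) :
    lowerDensityLeft K α ≤ density K α (Icc 0 x) :=
  csInf_le (bddBelow_densities K fun x => Icc 0 x) ⟨x, hx, hx1, rfl⟩

theorem lowerDensityRight_le (hx : 0 < x) (hx1 : x ≤ 1) :
    lowerDensityRight K α ≤ density K α (Icc (1 - x) 1) :=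
  csInf_le (bddBelow_densities K fun x => Icc (1 - x) 1) ⟨x, hx, hx1, rfl⟩

/-- If r^(N+1) < x ≤ r^N, then [0, x] contains the image of K under N + 1 iterates of the first map,
of mass r^((N+1)α) ≥ (r x)^α. Positivity of the lower densities makes the threshold for island
lengths positive. -/
theorem ratio_rpow_le_lowerDensityLeft (h : IsNormalized Φ K M)
    (h0 : Measure.hausdorffMeasure α K ≠ 0) (ht : Measure.hausdorffMeasure α K ≠ ⊤) :
    Φ.ratio 0 ^ (α : ℝ) ≤ lowerDensityLeft K α := by
  refine le_csInf ⟨_, 1, one_pos, le_rfl, rfl⟩ ?_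
  rintro _ ⟨x, hx, hx1, rfl⟩
  set r := Φ.ratio 0 with hr
  have hr0 : 0 < r := Φ.ratio_pos 0
  obtain ⟨N, hN1, hN2⟩ := exists_nat_pow_near_of_lt_one hx hx1 hr0 (Φ.ratio_lt_one 0)
  have hiter : ∀ N : ℕ, ∀ z ∈ K, r ^ N * z + 0 ∈ K := by
    intro N
    induction N with
    | zero => intro z hz; simpa using hz
    | succ N ih =>
      intro z hz
      have h1 := h.isAttractor.wordMap_mem [0] (ih z hz)
      have h2 := h.map_zero
      simp only [map, mul_zero, zero_add] at h2
      simp only [wordMap, map, Function.comp_apply, id, h2] at h1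
      convert h1 using 1
      rw [pow_succ']
      ring
  have hmass := rpow_mul_normalizedMeasure_le (α := α) ht (pow_pos hr0 (N + 1)) (hiter (N + 1))
    (A := Icc 0 1) (B := Icc 0 x) fun z hz => by
      have : 0 < r ^ (N + 1) := by positivity
      exact ⟨by nlinarith [hz.1], by nlinarith [hz.2]⟩
  rw [normalizedMeasure_of_subset h0 ht h.subset_Icc, mul_one] at hmass
  rw [density_Icc hx.le, sub_zero, le_div_iff₀ (by positivity)]
  refine le_trans ?_ hmass
  rw [← Real.mul_rpow hr0.le hx.le, pow_succ']
  gcongr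

theorem ratio_rpow_le_lowerDensityRight (h : IsNormalized Φ K M)
    (h0 : Measure.hausdorffMeasure α K ≠ 0) (ht : Measure.hausdorffMeasure α K ≠ ⊤) :
    Φ.ratio (Fin.last (n + 1)) ^ (α : ℝ) ≤ lowerDensityRight K α := by
  refine le_csInf ⟨_, 1, one_pos, le_rfl, rfl⟩ ?_
  rintro _ ⟨x, hx, hx1, rfl⟩
  set r := Φ.ratio (Fin.last (n + 1)) with hr
  have hr0 : 0 < r := Φ.ratio_pos _
  obtain ⟨N, hN1, hN2⟩ := exists_nat_pow_near_of_lt_one hx hx1 hr0 (Φ.ratio_lt_one _)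
  have hiter : ∀ N : ℕ, ∀ z ∈ K, r ^ N * z + (1 - r ^ N) ∈ K := by
    intro N
    induction N with
    | zero => intro z hz; simpa using hz
    | succ N ih =>
      intro z hz
      have h1 := h.isAttractor.wordMap_mem [Fin.last (n + 1)] (ih z hz)
      have h2 := h.map_one
      simp only [map, ← hr] at h2
      simp only [wordMap, map, Function.comp_apply, id, ← hr] at h1
      convert h1 using 1
      rw [pow_succ']
      linear_combination -h2
  have hmass := rpow_mul_normalizedMeasure_le (α := α) ht (pow_pos hr0 (N + 1)) (hiter (N + 1))
    (A := Icc 0 1) (B := Icc (1 - x) 1) fun z hz => by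
      have : 0 < r ^ (N + 1) := by positivity
      exact ⟨by nlinarith [hz.1], by nlinarith [hz.2]⟩
  rw [normalizedMeasure_of_subset h0 ht h.subset_Icc, mul_one] at hmass
  rw [density_Icc (by linarith), sub_sub_cancel, le_div_iff₀ (by positivity)]
  refine le_trans ?_ hmass
  rw [← Real.mul_rpow hr0.le hx.le, pow_succ']
  gcongr

/-- The maximal density is attained, by an interval that is at least as long as the shortest lake
of generation `k₀ + 1`. -/
theorem exists_isMax_density (h : IsNormalized Φ K M) (hint : interior K = ∅)
    (hk₀ : Φ.NoNewType M k₀) (hlake : 0 < Φ.lakeMin M (k₀ + 1)) (hα0 : 0 < α)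
    (ht : Measure.hausdorffMeasure α K ≠ ⊤) :
    ∃ p q, 0 ≤ p ∧ q ≤ 1 ∧ p + Φ.lakeMin M (k₀ + 1) ≤ q ∧
      ∀ c ∈ densities K α, c ≤ density K α (Icc p q) := by
  set γ := Φ.lakeMin M (k₀ + 1) with hγ
  obtain ⟨G, hG, hGeq⟩ := exists_continuous_normalizedMeasure (K := K) hα0 ht
  set T : Set (ℝ × ℝ) := (Icc 0 1 ×ˢ Icc 0 1) ∩ {z | z.1 + γ ≤ z.2} with hT
  have hTc : IsCompact T := (isCompact_Icc.prod isCompact_Icc).inter_right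
    (isClosed_le (by fun_prop) (by fun_prop))
  -- Blowing up preserves density, so intervals shorter than γ contribute no new values and the
  -- compact set T suffices.
  have hred : ∀ x ∈ K, ∀ y ∈ K, x < y → ∃ z ∈ T, density K α (Icc x y)
      = density K α (Icc z.1 z.2) := by
    intro x hx y hy hxy
    obtain ⟨k, a, b, k', s, t, hab, hxab, hyab, hst, hle⟩ :=
      h.exists_islandSimilar_lakeMin_le hint hk₀ hlake hx hy hxy
    refine ⟨(s * x + t, s * y + t), ⟨⟨h.subset_Icc ((hst.mem_iff x hxab).1 hx),
      h.subset_Icc ((hst.mem_iff y hyab).1 hy)⟩, ?_⟩, (hst.density_eq hxab hyab hxy).symm⟩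
    change s * x + t + γ ≤ s * y + t
    linarith
  have hcont : ContinuousOn (fun z : ℝ × ℝ => (G z.2 - G z.1) / (z.2 - z.1) ^ (α : ℝ)) T := by
    refine ContinuousOn.div (by fun_prop) ?_ fun z hz => ?_
    · exact ContinuousOn.rpow_const (by fun_prop) fun z _ => Or.inr α.coe_nonneg
    · have : z.1 + γ ≤ z.2 := hz.2
      exact (Real.rpow_pos_of_pos (by linarith) _).ne'
  have hd : ∀ z ∈ T, density K α (Icc z.1 z.2) = (G z.2 - G z.1) / (z.2 - z.1) ^ (α : ℝ) := by
    intro z hz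
    have : z.1 + γ ≤ z.2 := hz.2
    rw [density_Icc (by linarith), hGeq _ _ (by linarith)]
  have hTne : T.Nonempty := by
    obtain ⟨z, hz, -⟩ := hred 0 h.zero_mem 1 h.one_mem one_pos
    exact ⟨z, hz⟩
  obtain ⟨z, hz, hmax⟩ := hTc.exists_isMaxOn hTne hcont
  refine ⟨z.1, z.2, hz.1.1.1, hz.1.2.2, hz.2, ?_⟩
  rintro _ ⟨J, hJ, -, -, rfl⟩
  rcases Set.subsingleton_or_nontrivial (K ∩ J) with hs | hnt
  · rw [density_eq_zero_of_subsingleton hα0 hs]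
    exact density_nonneg
  · obtain ⟨x, hx, y, hy, hxy, hle⟩ := density_le_density_Icc h.isAttractor.isCompact ht
      ((Metric.isBounded_Icc 0 1).subset hJ) hnt
    obtain ⟨w, hw, he⟩ := hred x hx y hy hxy
    refine hle.trans ?_
    rw [he, hd w hw, hd z hz]
    exact hmax hw

end IsNormalized

end LinearIFS

end

/-! ### Endpoints of intervals of maximal density, and the conclusion. -/

noncomputable section

namespace LinearIFS

namespace IsNormalized

variable {n : ℕ} {Φ : LinearIFS (n + 2)} {K : Set ℝ} {M : ℕ → Finset (List (Fin (n + 2)))}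
  {α : ℝ≥0} {k : ℕ} {a b x p q γ : ℝ} {f : ℝ → ℝ}

/-- The vertex maps K into K and an initial interval [0, y] onto [f 0, x]. Thus the lower density at
0 controls the mass at the left end of every vertex interval, and overlaps only add mass. -/
theorem lowerDensityLeft_mul_rpow_le (h : IsNormalized Φ K M)
    (ht : Measure.hausdorffMeasure α K ≠ ⊤) (hf : f ∈ Φ.vertexMaps M k) (hx0 : f 0 < x)
    (hx1 : x ≤ f 1) :
    lowerDensityLeft K α * (x - f 0) ^ (α : ℝ) ≤ normalizedMeasure K α (Icc (f 0) x) := by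
  have hlt := sub_pos.2 (h.vertex_lt hf)
  have hy : 0 < (x - f 0) / (f 1 - f 0) := div_pos (by linarith) hlt
  have hy1 : (x - f 0) / (f 1 - f 0) ≤ 1 := by
    rw [div_le_one hlt]
    linarith
  set y := (x - f 0) / (f 1 - f 0) with hydef
  have hxy : x - f 0 = (f 1 - f 0) * y := by rw [hydef]; field_simp
  have hmass := rpow_mul_normalizedMeasure_le (α := α) ht hlt (t := f 0)
    (fun z hz => h.vertex_apply hf z ▸ h.vertex_mem hf hz) (A := Icc 0 y) (B := Icc (f 0) x)
    fun z hz => ⟨by nlinarith [hz.1], by nlinarith [hz.2]⟩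
  have hd := lowerDensityLeft_le (K := K) (α := α) hy hy1
  rw [density_Icc hy.le, sub_zero, le_div_iff₀ (by positivity)] at hd
  refine le_trans ?_ hmass
  rw [hxy, Real.mul_rpow hlt.le hy.le]
  have := mul_le_mul_of_nonneg_left hd (Real.rpow_nonneg hlt.le (α : ℝ))
  linarith

theorem lowerDensityRight_mul_rpow_le (h : IsNormalized Φ K M)
    (ht : Measure.hausdorffMeasure α K ≠ ⊤) (hf : f ∈ Φ.vertexMaps M k) (hx0 : f 0 ≤ x)
    (hx1 : x < f 1) :
    lowerDensityRight K α * (f 1 - x) ^ (α : ℝ) ≤ normalizedMeasure K α (Icc x (f 1)) := by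
  have hlt := sub_pos.2 (h.vertex_lt hf)
  have hy : 0 < (f 1 - x) / (f 1 - f 0) := div_pos (by linarith) hlt
  have hy1 : (f 1 - x) / (f 1 - f 0) ≤ 1 := by
    rw [div_le_one hlt]
    linarith
  set y := (f 1 - x) / (f 1 - f 0) with hydef
  have hxy : f 1 - x = (f 1 - f 0) * y := by rw [hydef]; field_simp
  have hmass := rpow_mul_normalizedMeasure_le (α := α) ht hlt (t := f 0)
    (fun z hz => h.vertex_apply hf z ▸ h.vertex_mem hf hz) (A := Icc (1 - y) 1) (B := Icc x (f 1))
    fun z hz => ⟨by nlinarith [hz.1], by nlinarith [hz.2]⟩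
  have hd := lowerDensityRight_le (K := K) (α := α) hy hy1
  rw [density_Icc (by linarith), sub_sub_cancel, le_div_iff₀ (by positivity)] at hd
  refine le_trans ?_ hmass
  rw [hxy, Real.mul_rpow hlt.le hy.le]
  have := mul_le_mul_of_nonneg_left hd (Real.rpow_nonneg hlt.le (α : ℝ))
  linarith

/-- If the vertices of generation `k` are short, then an interval of maximal density begins and
ends outside the open intervals of generation `k`. -/
theorem endpoints_notMem_openUnion (h : IsNormalized Φ K M) (hα0 : 0 < α) (hα1 : α < 1)
    (h0 : Measure.hausdorffMeasure α K ≠ 0) (ht : Measure.hausdorffMeasure α K ≠ ⊤)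
    (hγ : 0 < γ) (hp : 0 ≤ p) (hq : q ≤ 1) (hpq : p + γ ≤ q)
    (hmax : ∀ c ∈ densities K α, c ≤ density K α (Icc p q))
    (hk : Φ.islandMax M k ≤ (γ * min (lowerDensityLeft K α) (lowerDensityRight K α))
      ^ (1 / (1 - (α : ℝ)))) :
    p ∉ Φ.openUnion M k ∧ q ∉ Φ.openUnion M k := by
  have hlt : p < q := by linarith
  obtain ⟨G, -, hG⟩ := exists_continuous_normalizedMeasure (K := K) hα0 ht
  have hD0 : 0 ≤ lowerDensityLeft K α := (Real.rpow_nonneg (Φ.ratio_pos _).le _).trans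
    (h.ratio_rpow_le_lowerDensityLeft h0 ht)
  have hD1 : 0 ≤ lowerDensityRight K α := (Real.rpow_nonneg (Φ.ratio_pos _).le _).trans
    (h.ratio_rpow_le_lowerDensityRight h0 ht)
  have hα1' : (α : ℝ) < 1 := hα1
  have hα1'' : 0 ≤ 1 / (1 - (α : ℝ)) := one_div_nonneg.2 (by linarith)
  have hle : ∀ u v, 0 ≤ u → v ≤ 1 → u < v →
      normalizedMeasure K α (Icc u v) ≤ density K α (Icc p q) * (v - u) ^ (α : ℝ) := by
    intro u v hu hv huv
    rw [normalizedMeasure_Icc_eq huv]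
    refine mul_le_mul_of_nonneg_right (hmax _ ⟨_, Icc_subset_Icc hu hv, ordConnected_Icc, ?_, rfl⟩)
      (Real.rpow_nonneg (sub_pos.2 huv).le _)
    exact ⟨u, left_mem_Icc.2 huv.le, v, right_mem_Icc.2 huv.le, huv.ne⟩
  have hlen : ∀ g ∈ Φ.vertexMaps M k, g 1 - g 0 ≤ Φ.islandMax M k := by
    intro g hg
    obtain ⟨c, d, hcd, hc, hd⟩ := h.exists_island_of_vertex hg
    linarith [h.length_le_islandMax hcd]
  constructor
  · intro hpU
    obtain ⟨g, hg, hg0, hg1⟩ := h.mem_openUnion.1 hpU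
    -- The extension of [p, q] to `g 0` adds this much mass, so maximality forces p - g 0 above the
    -- threshold, yet it is shorter than a vertex interval.
    have h1 := h.lowerDensityLeft_mul_rpow_le ht hg hg0 hg1.le
    have h2 := hle (g 0) q (h.vertex_nonneg hg) hq (by linarith)
    have h3 : normalizedMeasure K α (Icc (g 0) q)
        = normalizedMeasure K α (Icc (g 0) p) + normalizedMeasure K α (Icc p q) := by
      rw [hG _ _ hg0.le, hG _ _ hlt.le, hG _ _ (by linarith)]
      ring
    have h4 := rpow_lt_of_extension (L := q - p) α.coe_nonneg hα1' hγ (by linarith) hD0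
      (sub_pos.2 hg0) (normalizedMeasure_Icc_eq hlt) normalizedMeasure_nonneg
      (normalizedMeasure_le_one ht) (by
        rw [show q - p + (p - g 0) = q - g 0 by ring]
        linarith)
    have h5 : (γ * min (lowerDensityLeft K α) (lowerDensityRight K α)) ^ (1 / (1 - (α : ℝ)))
        ≤ (γ * lowerDensityLeft K α) ^ (1 / (1 - (α : ℝ))) := by
      refine Real.rpow_le_rpow (mul_nonneg hγ.le (le_min hD0 hD1)) ?_ hα1''
      gcongr
      exact min_le_left _ _
    linarith [hlen g hg]
  · intro hqU
    obtain ⟨g, hg, hg0, hg1⟩ := h.mem_openUnion.1 hqU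
    have h1 := h.lowerDensityRight_mul_rpow_le ht hg hg0.le hg1
    have h2 := hle p (g 1) hp (h.vertex_le_one hg) (by linarith)
    have h3 : normalizedMeasure K α (Icc p (g 1))
        = normalizedMeasure K α (Icc p q) + normalizedMeasure K α (Icc q (g 1)) := by
      rw [hG _ _ hg1.le, hG _ _ hlt.le, hG _ _ (by linarith)]
      ring
    have h4 := rpow_lt_of_extension (L := q - p) α.coe_nonneg hα1' hγ (by linarith) hD1
      (sub_pos.2 hg1) (normalizedMeasure_Icc_eq hlt) normalizedMeasure_nonneg
      (normalizedMeasure_le_one ht) (by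
        rw [show q - p + (g 1 - q) = g 1 - p by ring]
        linarith)
    have h5 : (γ * min (lowerDensityLeft K α) (lowerDensityRight K α)) ^ (1 / (1 - (α : ℝ)))
        ≤ (γ * lowerDensityRight K α) ^ (1 / (1 - (α : ℝ))) := by
      refine Real.rpow_le_rpow (mul_nonneg hγ.le (le_min hD0 hD1)) ?_ hα1''
      gcongr
      exact min_le_right _ _
    linarith [hlen g hg]

/-- An interval of maximal density whose endpoints lie outside the open intervals of generation `k`
begins and ends with an island of generation `k`. -/
theorem mem_fieldIntervals_of_isMax (h : IsNormalized Φ K M) (hα0 : 0 < α)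
    (h0 : Measure.hausdorffMeasure α K ≠ 0) (ht : Measure.hausdorffMeasure α K ≠ ⊤)
    (hp : 0 ≤ p) (hq : q ≤ 1) (hpq : p < q)
    (hmax : ∀ c ∈ densities K α, c ≤ density K α (Icc p q))
    (hpU : p ∉ Φ.openUnion M k) (hqU : q ∉ Φ.openUnion M k) :
    Icc p q ∈ Φ.fieldIntervals M k := by
  have hatom := Measure.nullSingletonClass_hausdorff ℝ (d := (α : ℝ)) hα0
  have hmem : ∀ u v, 0 ≤ u → v ≤ 1 → u < v → density K α (Icc u v) ∈ densities K α :=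
    fun u v hu hv huv => ⟨_, Icc_subset_Icc hu hv, ordConnected_Icc,
      ⟨u, left_mem_Icc.2 huv.le, v, right_mem_Icc.2 huv.le, huv.ne⟩, rfl⟩
  have hdpos : 0 < density K α (Icc p q) := by
    refine lt_of_lt_of_le ?_ (hmax _ (hmem 0 1 le_rfl le_rfl one_pos))
    rw [density_Icc zero_le_one, normalizedMeasure_of_subset h0 ht h.subset_Icc]
    norm_num
  -- A shorter interval with at least the same mass would have a larger density.
  have hnull : ∀ u v, 0 ≤ u → v ≤ 1 → u < v → v - u < q - p →
      ¬ normalizedMeasure K α (Icc p q) ≤ normalizedMeasure K α (Icc u v) := by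
    intro u v hu hv huv hlt hle
    rw [normalizedMeasure_Icc_eq hpq, normalizedMeasure_Icc_eq huv] at hle
    have h1 := hmax _ (hmem u v hu hv huv)
    have h2 : (v - u) ^ (α : ℝ) < (q - p) ^ (α : ℝ) :=
      Real.rpow_lt_rpow (sub_pos.2 huv).le hlt hα0
    have h3 : 0 ≤ (v - u) ^ (α : ℝ) := Real.rpow_nonneg (sub_pos.2 huv).le _
    nlinarith
  have hfin := h.finite_islands k
  have hleft : ∃ d, Φ.IsIsland M k p d := by
    by_contra hcon
    push Not at hcon
    -- Choose w so close to p that no island starts in (p, w]. If none starts at p either, K misses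
    -- (p, w): an island meeting it would start before p and put p in the open union. Cutting off
    -- [p, w) then loses only the null set {p}.
    have hev : ∀ᶠ w in nhdsWithin p (Ioi p),
        ∀ I ∈ hfin.toFinset, p < I.1 → w < I.1 := by
      rw [Finset.eventually_all]
      intro I _
      rw [eventually_imp_distrib_left]
      exact fun hI => nhdsWithin_le_nhds (gt_mem_nhds hI)
    obtain ⟨w, hw, hpw, hwq⟩ := (hev.and (Ioo_mem_nhdsGT hpq)).exists
    refine hnull w q (hp.trans hpw.le) hq hwq (by linarith) ?_
    refine div_le_div_of_nonneg_right (ENNReal.toReal_mono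
      (ne_top_of_le_ne_top ht (measure_mono inter_subset_left)) ?_) (by positivity)
    calc _ ≤ Measure.hausdorffMeasure (α : ℝ) (K ∩ Icc w q ∪ {p}) := measure_mono ?_
      _ ≤ Measure.hausdorffMeasure (α : ℝ) (K ∩ Icc w q) + Measure.hausdorffMeasure (α : ℝ) {p} :=
          measure_union_le _ _
      _ = _ := by rw [measure_singleton, add_zero]
    rintro z ⟨hzK, hz⟩
    by_contra hn
    simp only [mem_union, mem_inter_iff, mem_Icc, mem_singleton_iff, not_or, not_and, not_le] at hn
    have hzw : z < w := by
      by_contra hle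
      exact absurd (hn.1 hzK (not_lt.1 hle)) (not_lt.2 hz.2)
    have hpz : p < z := hz.1.lt_of_ne (Ne.symm hn.2)
    obtain ⟨c, d, hcd, hzc, hzd⟩ := h.exists_island_of_mem k hzK
    rcases lt_trichotomy p c with hlt | rfl | hlt
    · linarith [hw (c, d) (hfin.mem_toFinset.2 hcd) hlt]
    · exact hcon d hcd
    · exact hpU (hcd.subset ⟨hlt, hpz.trans_le hzd⟩)
  have hright : ∃ c, Φ.IsIsland M k c q := by
    by_contra hcon
    push Not at hcon
    have hev : ∀ᶠ w in nhdsWithin q (Iio q),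
        ∀ I ∈ hfin.toFinset, I.2 < q → I.2 < w := by
      rw [Finset.eventually_all]
      intro I _
      rw [eventually_imp_distrib_left]
      exact fun hI => nhdsWithin_le_nhds (lt_mem_nhds hI)
    obtain ⟨w, hw, hpw, hwq⟩ := (hev.and (Ioo_mem_nhdsLT hpq)).exists
    refine hnull p w hp (hwq.le.trans hq) hpw (by linarith) ?_
    refine div_le_div_of_nonneg_right (ENNReal.toReal_mono
      (ne_top_of_le_ne_top ht (measure_mono inter_subset_left)) ?_) (by positivity)
    calc _ ≤ Measure.hausdorffMeasure (α : ℝ) (K ∩ Icc p w ∪ {q}) := measure_mono ?_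
      _ ≤ Measure.hausdorffMeasure (α : ℝ) (K ∩ Icc p w) + Measure.hausdorffMeasure (α : ℝ) {q} :=
          measure_union_le _ _
      _ = _ := by rw [measure_singleton, add_zero]
    rintro z ⟨hzK, hz⟩
    by_contra hn
    simp only [mem_union, mem_inter_iff, mem_Icc, mem_singleton_iff, not_or, not_and, not_le] at hn
    have hzw : w < z := hn.1 hzK hz.1
    have hzq : z < q := hz.2.lt_of_ne hn.2
    obtain ⟨c, d, hcd, hzc, hzd⟩ := h.exists_island_of_mem k hzK
    rcases lt_trichotomy d q with hlt | rfl | hlt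
    · linarith [hw (c, d) (hfin.mem_toFinset.2 hcd) hlt]
    · exact hcon c hcd
    · exact hqU (hcd.subset ⟨hzc.trans_lt hzq, hlt⟩)
  obtain ⟨d, hd⟩ := hleft
  obtain ⟨c, hc⟩ := hright
  refine ⟨Icc p d, (h.Icc_mem_islands hd.lt.le).2 hd, Icc c q, (h.Icc_mem_islands hc.lt.le).2 hc, ?_⟩
  rw [csInf_Icc hd.lt.le, csSup_Icc hc.lt.le]
  exact ⟨hpq, rfl⟩

end IsNormalized

end LinearIFS

end

theorem theorem4p8 (n : ℕ) (Φ : LinearIFS (n + 2)) (K : Set ℝ)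
    (M : ℕ → Finset (List (Fin (n + 2)))) (α : ℝ≥0) (k₀ : ℕ)
    (hK : Φ.IsAttractor K)
    (hfirst : Φ.map 0 0 = 0)
    (hlast : Φ.map (Fin.last (n + 1)) 1 = 1)
    (hM : Φ.GeneralizedFiniteType M)
    (hα : dimH K = α) (hα1 : α < 1)
    (hirr : (Φ.incidenceMatrix M α).IsIrreducible)
    (hA : Φ.AssumptionA M)
    (hB : Φ.AssumptionB K)
    (hk₀ : IsLeast {k | Φ.NoNewType M k} k₀)
    (hlakes : 0 < Φ.lakeMin M (k₀ + 1)) :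
    ∃ k : ℕ,
      IsLeast {k : ℕ | k₀ + 1 ≤ k ∧
        2 * Φ.islandMax M k ≤
          (Φ.lakeMin M (k₀ + 1) * min (lowerDensityLeft K α) (lowerDensityRight K α))
            ^ (1 / (1 - (α : ℝ)))} k ∧
      ∃ J ∈ Φ.fieldIntervals M k,
        IsGreatest (densities K α) (density K α J) ∧
        density K α J = maxDensity K α ∧
        0 < Measure.hausdorffMeasure α K ∧ Measure.hausdorffMeasure α K < ⊤ ∧
        (Measure.hausdorffMeasure α K).toReal = (maxDensity K α)⁻¹ := by
  have h : LinearIFS.IsNormalized Φ K M := ⟨hK, hfirst, hlast, hM⟩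
  -- A set with interior points has dimension 1 > α.
  have hint : interior K = ∅ := by
    by_contra hne
    have h1 := Real.dimH_of_nonempty_interior (nonempty_iff_ne_empty.2 hne)
    rw [hα, Module.finrank_self, Nat.cast_one] at h1
    exact hα1.ne (by exact_mod_cast h1)
  have hα0 := h.dimension_pos hk₀.1 hlakes hα
  obtain ⟨c, hc, hcov⟩ := h.hasSimilarCover hint hk₀.1 hlakes
  have ht := hausdorffMeasure_ne_top_of_hasSimilarCover hK.isCompact hK.nonempty h.subset_Icc hα hc
    hcov
  have h0 := h.hausdorffMeasure_ne_zero hint hk₀.1 hlakes hα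
  have hHpos := ENNReal.toReal_pos h0 ht
  set γ := Φ.lakeMin M (k₀ + 1) with hγ
  set R := (γ * min (lowerDensityLeft K α) (lowerDensityRight K α)) ^ (1 / (1 - (α : ℝ))) with hR
  have hRpos : 0 < R := by
    refine Real.rpow_pos_of_pos (mul_pos hlakes (lt_min ?_ ?_)) _
    · exact (Real.rpow_pos_of_pos (Φ.ratio_pos _) _).trans_le
        (h.ratio_rpow_le_lowerDensityLeft h0 ht)
    · exact (Real.rpow_pos_of_pos (Φ.ratio_pos _) _).trans_le
        (h.ratio_rpow_le_lowerDensityRight h0 ht)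
  have hne : {k : ℕ | k₀ + 1 ≤ k ∧ 2 * Φ.islandMax M k ≤ R}.Nonempty := by
    obtain ⟨k, hk, hle⟩ := ((h.tendsto_islandMax hint (half_pos hRpos)).and
      (eventually_ge_atTop (k₀ + 1))).exists
    exact ⟨k, hle, by linarith⟩
  set k := sInf {k : ℕ | k₀ + 1 ≤ k ∧ 2 * Φ.islandMax M k ≤ R} with hkdef
  have hk := Nat.sInf_mem hne
  rw [← hkdef] at hk
  obtain ⟨p, q, hp, hq, hpq, hmax⟩ := h.exists_isMax_density hint hk₀.1 hlakes hα0 ht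
  have hlt : p < q := by linarith
  have hkle : Φ.islandMax M k ≤ R := by
    have : 0 ≤ Φ.islandMax M k :=
      Real.sSup_nonneg (by rintro _ ⟨I, -, rfl⟩; exact Metric.diam_nonneg)
    linarith [hk.2]
  obtain ⟨hpU, hqU⟩ :=
    h.endpoints_notMem_openUnion hα0 hα1 h0 ht hlakes hp hq hpq hmax hkle
  have hgreat : IsGreatest (densities K α) (density K α (Icc p q)) :=
    ⟨⟨_, Icc_subset_Icc hp hq, ordConnected_Icc,
      ⟨p, left_mem_Icc.2 hlt.le, q, right_mem_Icc.2 hlt.le, hlt.ne⟩, rfl⟩, fun c hc => hmax c hc⟩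
  have hmaxD : density K α (Icc p q) = maxDensity K α := hgreat.csSup_eq.symm
  refine ⟨k, ⟨hk, fun j hj => Nat.sInf_le hj⟩, Icc p q,
    h.mem_fieldIntervals_of_isMax hα0 h0 ht hp hq hlt hmax hpU hqU, hgreat, hmaxD,
    pos_iff_ne_zero.2 h0, lt_top_iff_ne_top.2 ht, ?_⟩
  rw [← hmaxD]
  set H := (Measure.hausdorffMeasure α K).toReal with hH
  -- The local bound at the maximizing interval gives this half; the mass distribution principle
  -- gives the other.
  have hle : density K α (Icc p q) * H ≤ 1 := by
    have h1 := ENNReal.toReal_mono ENNReal.ofReal_ne_top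
      (hausdorffMeasure_inter_Icc_le hK.isCompact hc h0 ht hcov hp hlt.le hq)
    have hpos : 0 < (q - p) ^ (α : ℝ) := Real.rpow_pos_of_pos (sub_pos.2 hlt) _
    rw [ENNReal.toReal_ofReal hpos.le] at h1
    rw [density_Icc hlt.le, normalizedMeasure, ← hH, div_right_comm,
      div_mul_cancel₀ _ hHpos.ne']
    exact (div_le_one hpos).2 h1
  have hdens : ∀ x ∈ K, ∀ y ∈ K, x < y → density K α (Icc x y) ≤ density K α (Icc p q) :=
    fun x hx y hy hxy => hmax _ ⟨_, Icc_subset_Icc (h.subset_Icc hx).1 (h.subset_Icc hy).2,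
      ordConnected_Icc, ⟨x, left_mem_Icc.2 hxy.le, y, right_mem_Icc.2 hxy.le, hxy.ne⟩, rfl⟩
  have hdpos : 0 < density K α (Icc p q) := by
    refine lt_of_lt_of_le ?_ (hdens 0 h.zero_mem 1 h.one_mem one_pos)
    rw [density_Icc zero_le_one, normalizedMeasure_of_subset h0 ht h.subset_Icc]
    norm_num
  have hge := one_le_mul_of_density_le hK.isCompact hα0 h0 ht hdpos hdens
  exact eq_inv_of_mul_eq_one_right (le_antisymm hle hge)
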